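/- Let $M$ be a smooth $3$-dimensional manifold. A metric on $M$ is a smooth, symmetric, non-degenerate $(0,2)$-tensor field of arbitrary signature; two metrics are projectively equivalent if they have the same unparametrised geodesics (curves with $\nabla_{\dot\gamma}\dot\gamma=f(t)\dot\gamma$ for some function $f$); a smooth vector field is projective for $g$ if its local flow maps unparametrised geodesics of $g$ to unparametrised geodesics of $g$. To a metric $g$ associate the weighted tensor field $\sigma_g^{ij}=|\det g|^{1/4}g^{ij}$, a section of $S^2(TM)\otimes(\Lambda^3M)^{1/2}$. The degree of mobility of $g$ is the dimension of the real vector space of smooth sections $\sigma$ of this bundle that satisfy $$\nabla_a\sigma^{bc}-\tfrac14\big(\delta^c_a\nabla_i\sigma^{ib}+\delta^b_a\nabla_i\sigma^{ic}\big)=0,$$ where $\nabla$ is the Levi-Civita connection of $g$. Let $g$ be a metric on $M$ of degree of mobility $2$, let $v$ be a projective vector field for $g$, and let $\bar g$ be a metric that is projectively equivalent to $g$ and not a constant multiple of $g$. Put $\sigma=\sigma_g$, $\bar\sigma=\sigma_{\bar g}$, and let $\mathcal L_v$ be the Lie derivative along $v$. Then there is a unique real matrix $A=\begin{pmatrix}a&b\\c&d\end{pmatrix}$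 with $$\mathcal L_v\sigma=a\sigma+b\bar\sigma,\qquad \mathcal L_v\bar\sigma=c\sigma+d\bar\sigma .$$ Let $S_A(t)=-bt^2+(d-a)t+c$ be the corresponding Solodovnikov polynomial, and let $$L=L(g,\bar g)=\left|\frac{\det\bar g}{\det g}\right|^{1/4}\bar g^{-1}g$$ be the Benenti tensor. If $\lambda$ is a differentiable (real- or complex-valued) function on an open set $U\subseteq M$ such that $\lambda(x)$ is an eigenvalue of $L_x$ for every $x\in U$, then $$S_A(\lambda)=v(\lambda)\quad\text{on }U.$$ In particular, if $\lambda$ is constant on a non-empty open set $U$, then this constant is a root of $S_A$. -/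

import Mathlib

open Set
open scoped Manifold ContDiff

noncomputable section

namespace ProjGeom

/-- The model space `ℝⁿ`. -/
abbrev E (n : ℕ) : Type := EuclideanSpace ℝ (Fin n)

/-- The `i`-th standard basis vector of `ℝⁿ`. -/
def stdVec {n : ℕ} (i : Fin n) : E n := EuclideanSpace.single i 1

/-- The partial derivative `f_{,i}` at `y` of a function on (an open subset of) `ℝⁿ`. -/
def pd {n : ℕ} (f : E n → ℝ) (i : Fin n) (y : E n) : ℝ := fderiv ℝ f y (stdVec i)

/-! ### Formulas in a coordinate domain of `ℝⁿ` -/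

/-- Christoffel symbols `Γ^k_{ij} = ½ g^{kh} (g_{jh,i} + g_{ih,j} - g_{ij,h})` of the Levi-Civita
connection of the metric with component matrix `G`. -/
def christoffel {n : ℕ} (G : E n → Matrix (Fin n) (Fin n) ℝ) (y : E n) (k i j : Fin n) : ℝ :=
  (1 / 2) * ∑ h, (G y)⁻¹ k h *
    (pd (fun z => G z j h) i y + pd (fun z => G z i h) j y - pd (fun z => G z i j) h y)

/-- `∇_a σ^{bc}` for a section `σ` of `S²(TM) ⊗ (ΛⁿM)^{2/(n+1)}` with component matrix `S`. -/
def covDeriv {n : ℕ} (G S : E n → Matrix (Fin n) (Fin n) ℝ) (y : E n) (a b c : Fin n) : ℝ :=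
  pd (fun z => S z b c) a y
    + ∑ d, christoffel G y b a d * S y d c
    + ∑ d, christoffel G y c a d * S y d b
    - (2 / ((n : ℝ) + 1)) * (∑ d, christoffel G y d d a) * S y b c

/-- The linear metrisability system at `y`:
`∇_a σ^{bc} - 1/(n+1) (δ^c_a ∇_i σ^{ib} + δ^b_a ∇_i σ^{ic}) = 0`. -/
def LinearSystemAt {n : ℕ} (G S : E n → Matrix (Fin n) (Fin n) ℝ) (y : E n) : Prop :=
  ∀ a b c : Fin n,
    covDeriv G S y a b c
      - (1 / ((n : ℝ) + 1)) *
        ((if c = a then 1 else 0) * ∑ i, covDeriv G S y i i b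
          + (if b = a then 1 else 0) * ∑ i, covDeriv G S y i i c) = 0

/-- The Lie derivative along `V` of a section of `S²(TM) ⊗ (ΛⁿM)^{2/(n+1)}`, in components:
`V^k σ^{ij}_{,k} - V^i_{,k} σ^{kj} - V^j_{,k} σ^{ik} + 2/(n+1) V^k_{,k} σ^{ij}`. -/
def lieDeriv {n : ℕ} (V : E n → E n) (S : E n → Matrix (Fin n) (Fin n) ℝ) (y : E n) :
    Matrix (Fin n) (Fin n) ℝ :=
  Matrix.of fun i j =>
    (∑ k, V y k * pd (fun z => S z i j) k y)
      - (∑ k, pd (fun z => V z i) k y * S y k j)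
      - (∑ k, pd (fun z => V z j) k y * S y i k)
      + (2 / ((n : ℝ) + 1)) * (∑ k, pd (fun z => V z k) k y) * S y i j

/-! ### Tensor fields on a smooth manifold -/

section Manifold

variable {n : ℕ} {M : Type*} [TopologicalSpace M] [ChartedSpace (E n) M]

/-- The smooth charts of `M`. -/
abbrev charts (n : ℕ) (M : Type*) [TopologicalSpace M] [ChartedSpace (E n) M] :
    Set (OpenPartialHomeomorph M (E n)) :=
  IsManifold.maximalAtlas (𝓡 n) ∞ M

/-- The coordinate vector `∂_i` of the chart `e` at the point with coordinates `y`. -/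
def coordVec (e : OpenPartialHomeomorph M (E n)) (y : E n) (i : Fin n) :
    TangentSpace (𝓡 n) (e.symm y) :=
  mfderiv (𝓡 n) (𝓡 n) e.symm y (stdVec i)

/-- The basis of `T_x M` that Mathlib's identification of `T_x M` with `ℝⁿ` provides
(the coordinate basis of the preferred chart at `x`). -/
def fibreVec (x : M) (i : Fin n) : TangentSpace (𝓡 n) x := (stdVec i : E n)

/-- The coordinates in the chart `e` of a tangent vector at `x`, i.e. `d e_x (u)`. -/
def vecCoords (e : OpenPartialHomeomorph M (E n)) (x : M) (u : TangentSpace (𝓡 n) x) : E n :=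
  mfderiv (𝓡 n) (𝓡 n) e x u

/-- The matrix of `d e_x : T_x M → ℝⁿ` in the basis `fibreVec x`. -/
def jac (e : OpenPartialHomeomorph M (E n)) (x : M) : Matrix (Fin n) (Fin n) ℝ :=
  Matrix.of fun i j => vecCoords e x (fibreVec x j) i

variable (n M) in
/-- A metric of arbitrary signature: a smooth, symmetric, non-degenerate `(0,2)`-tensor field. -/
structure Metric where
  /-- The bilinear form on each tangent space. -/
  form : ∀ x : M, LinearMap.BilinForm ℝ (TangentSpace (𝓡 n) x)
  symm : ∀ (x : M) (u w : TangentSpace (𝓡 n) x), form x u w = form x w u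
  nondegenerate : ∀ (x : M) (u : TangentSpace (𝓡 n) x), (∀ w, form x u w = 0) → u = 0
  smooth : ∀ e ∈ charts n M, ∀ i j : Fin n,
    ContDiffOn ℝ ∞ (fun y => form (e.symm y) (coordVec e y i) (coordVec e y j)) e.target

/-- The components `g_{ij}` in the chart `e`. -/
def Metric.comp (g : Metric n M) (e : OpenPartialHomeomorph M (E n)) (y : E n) :
    Matrix (Fin n) (Fin n) ℝ :=
  Matrix.of fun i j => g.form (e.symm y) (coordVec e y i) (coordVec e y j)

/-- The Gram matrix of `g` at `x` in the basis `fibreVec x` of `T_x M`. -/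
def Metric.gram (g : Metric n M) (x : M) : Matrix (Fin n) (Fin n) ℝ :=
  Matrix.of fun i j => g.form x (fibreVec x i) (fibreVec x j)

/-- The components `v^i` of a vector field in the chart `e`. -/
def vecComp (v : ∀ x : M, TangentSpace (𝓡 n) x) (e : OpenPartialHomeomorph M (E n)) (y : E n) :
    E n :=
  vecCoords e (e.symm y) (v (e.symm y))

variable (n M) in
/-- (Not necessarily continuous) sections of `TM ⊗ TM ⊗ (ΛⁿM)^{2/(n+1)}`; the value at `x` is
recorded by its components with respect to the basis `fibreVec x` of `T_x M`. -/
abbrev WeightedField : Type _ := M → Matrix (Fin n) (Fin n) ℝ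

/-- The components of `σ` in the chart `e`: the change of basis `J = jac e x` acts on the fibre by
`σ ↦ |det J|^{-2/(n+1)} J σ Jᵀ`. -/
def WeightedField.comp (σ : WeightedField n M) (e : OpenPartialHomeomorph M (E n)) (y : E n) :
    Matrix (Fin n) (Fin n) ℝ :=
  |(jac e (e.symm y)).det| ^ (-(2 / ((n : ℝ) + 1))) •
    (jac e (e.symm y) * σ (e.symm y) * (jac e (e.symm y)).transpose)

/-- The weighted field `σ = |det g|^{1/(n+1)} g⁻¹` of a metric. -/
def Metric.sigma (g : Metric n M) : WeightedField n M :=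
  fun x => |(g.gram x).det| ^ (1 / ((n : ℝ) + 1)) • (g.gram x)⁻¹

/-! ### The metrisation space and the degree of mobility -/

theorem WeightedField.comp_add (σ τ : WeightedField n M) (e : OpenPartialHomeomorph M (E n)) :
    WeightedField.comp (σ + τ) e = WeightedField.comp σ e + WeightedField.comp τ e := by
  funext y
  simp only [WeightedField.comp, Pi.add_apply, Matrix.mul_add, Matrix.add_mul, smul_add]

theorem WeightedField.comp_smul (r : ℝ) (σ : WeightedField n M)
    (e : OpenPartialHomeomorph M (E n)) :
    WeightedField.comp (r • σ) e = r • WeightedField.comp σ e := by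
  funext y
  simp only [WeightedField.comp, Pi.smul_apply, Matrix.mul_smul, Matrix.smul_mul]
  rw [smul_comm]

theorem pd_add {f h : E n → ℝ} {y : E n} (hf : DifferentiableAt ℝ f y)
    (hh : DifferentiableAt ℝ h y) (i : Fin n) :
    pd (fun z => f z + h z) i y = pd f i y + pd h i y := by
  simp only [pd]
  rw [fderiv_fun_add hf hh]
  rfl

theorem pd_smul {f : E n → ℝ} {y : E n} (hf : DifferentiableAt ℝ f y) (r : ℝ) (i : Fin n) :
    pd (fun z => r * f z) i y = r * pd f i y := by
  simp only [pd]
  rw [fderiv_const_mul hf]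
  rfl

theorem covDeriv_add {G S T : E n → Matrix (Fin n) (Fin n) ℝ} {y : E n}
    (hS : ∀ b c, DifferentiableAt ℝ (fun z => S z b c) y)
    (hT : ∀ b c, DifferentiableAt ℝ (fun z => T z b c) y) (a b c : Fin n) :
    covDeriv G (S + T) y a b c = covDeriv G S y a b c + covDeriv G T y a b c := by
  simp only [covDeriv, Pi.add_apply, Matrix.add_apply, mul_add, Finset.sum_add_distrib]
  rw [pd_add (hS b c) (hT b c)]
  ring

theorem covDeriv_smul {G S : E n → Matrix (Fin n) (Fin n) ℝ} {y : E n}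
    (hS : ∀ b c, DifferentiableAt ℝ (fun z => S z b c) y) (r : ℝ) (a b c : Fin n) :
    covDeriv G (r • S) y a b c = r * covDeriv G S y a b c := by
  simp only [covDeriv, Pi.smul_apply, Matrix.smul_apply, smul_eq_mul, mul_left_comm _ r,
    ← Finset.mul_sum]
  rw [pd_smul (hS b c)]
  ring

/-- The metrisation space of `g`: smooth sections of `S²(TM) ⊗ (ΛⁿM)^{2/(n+1)}` that solve the
linear metrisability system for the Levi-Civita connection of `g`. -/
def Metric.solSpace (g : Metric n M) : Submodule ℝ (WeightedField n M) where
  carrier := {σ | (∀ x, (σ x).IsSymm) ∧ ∀ e ∈ charts n M,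
    (∀ i j, ContDiffOn ℝ ∞ (fun y => WeightedField.comp σ e y i j) e.target) ∧
    ∀ y ∈ e.target, LinearSystemAt (g.comp e) (WeightedField.comp σ e) y}
  zero_mem' := by
    have h0 : ∀ e : OpenPartialHomeomorph M (E n),
        WeightedField.comp (0 : WeightedField n M) e = 0 := by
      intro e
      funext y
      simp [WeightedField.comp]
    refine ⟨fun x => Matrix.transpose_zero, fun e _ => ⟨fun i j => ?_, fun y _ a b c => ?_⟩⟩
    · rw [h0]
      exact contDiffOn_const
    · rw [h0]
      simp [covDeriv, pd]
  add_mem' := by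
    rintro σ τ ⟨hσ, hσ'⟩ ⟨hτ, hτ'⟩
    refine ⟨fun x => (hσ x).add (hτ x), fun e he => ⟨fun i j => ?_, fun y hy a b c => ?_⟩⟩
    · rw [WeightedField.comp_add]
      exact ((hσ' e he).1 i j).add ((hτ' e he).1 i j)
    · have d1 : ∀ b c, DifferentiableAt ℝ (fun z => WeightedField.comp σ e z b c) y := fun b c =>
        (((hσ' e he).1 b c).contDiffAt (e.open_target.mem_nhds hy)).differentiableAt (by simp)
      have d2 : ∀ b c, DifferentiableAt ℝ (fun z => WeightedField.comp τ e z b c) y := fun b c =>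
        (((hτ' e he).1 b c).contDiffAt (e.open_target.mem_nhds hy)).differentiableAt (by simp)
      have h1 := (hσ' e he).2 y hy a b c
      have h2 := (hτ' e he).2 y hy a b c
      rw [WeightedField.comp_add]
      simp only [covDeriv_add d1 d2, Finset.sum_add_distrib]
      linear_combination h1 + h2
  smul_mem' := by
    rintro r σ ⟨hσ, hσ'⟩
    refine ⟨fun x => (hσ x).smul r, fun e he => ⟨fun i j => ?_, fun y hy a b c => ?_⟩⟩
    · rw [WeightedField.comp_smul]
      exact contDiffOn_const.mul ((hσ' e he).1 i j)
    · have d1 : ∀ b c, DifferentiableAt ℝ (fun z => WeightedField.comp σ e z b c) y := fun b c =>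
        (((hσ' e he).1 b c).contDiffAt (e.open_target.mem_nhds hy)).differentiableAt (by simp)
      have h1 := (hσ' e he).2 y hy a b c
      rw [WeightedField.comp_smul]
      simp only [covDeriv_smul d1, ← Finset.mul_sum]
      linear_combination r * h1

/-- The degree of mobility: the dimension of the metrisation space. -/
def Metric.degreeOfMobility (g : Metric n M) : Cardinal := Module.rank ℝ g.solSpace

/-! ### Geodesics, projective equivalence, projective vector fields -/

/-- `γ` is an unparametrised geodesic of `g` on the open interval `I`: it is smooth and
`∇_γ' γ' = f(t) γ'` on `I` for some function `f`. -/
def Metric.IsGeodesic (g : Metric n M) (I : Set ℝ) (γ : ℝ → M) : Prop :=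
  ContMDiffOn 𝓘(ℝ, ℝ) (𝓡 n) ∞ γ I ∧
  ∃ f : ℝ → ℝ, ∀ t ∈ I, ∀ e ∈ charts n M, γ t ∈ e.source → ∀ k : Fin n,
    deriv (deriv fun s => e (γ s)) t k
      + ∑ i, ∑ j, christoffel (g.comp e) (e (γ t)) k i j
          * deriv (fun s => e (γ s)) t i * deriv (fun s => e (γ s)) t j
      = f t * deriv (fun s => e (γ s)) t k

/-- Two metrics are projectively equivalent if they have the same unparametrised geodesics. -/
def ProjectivelyEquivalent (g g' : Metric n M) : Prop :=
  ∀ (I : Set ℝ) (γ : ℝ → M), IsOpen I → I.OrdConnected →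
    (g.IsGeodesic I γ ↔ g'.IsGeodesic I γ)

/-- The metrics are constant multiples of each other. -/
def Proportional (g g' : Metric n M) : Prop :=
  ∃ c : ℝ, ∀ x, g'.form x = c • g.form x

/-- A vector field is smooth if its components in every chart are. -/
def IsSmoothVectorField (v : ∀ x : M, TangentSpace (𝓡 n) x) : Prop :=
  ∀ e ∈ charts n M, ContDiffOn ℝ ∞ (vecComp v e) e.target

/-- `φ` is the local flow of `v` for times in `(-ε, ε)` and initial points in `U`. -/
structure IsLocalFlow (v : ∀ x : M, TangentSpace (𝓡 n) x) (ε : ℝ) (U : Set M)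
    (φ : ℝ → M → M) : Prop where
  smooth : ContMDiffOn (𝓘(ℝ, ℝ).prod (𝓡 n)) (𝓡 n) ∞ (fun q : ℝ × M => φ q.1 q.2)
    (Ioo (-ε) ε ×ˢ U)
  initial : ∀ x ∈ U, φ 0 x = x
  integralCurve : ∀ x ∈ U, IsMIntegralCurveOn (fun t => φ t x) v (Ioo (-ε) ε)

/-- A smooth vector field is projective for `g` if its local flow (which exists and is unique near
each point) maps unparametrised geodesics of `g` to unparametrised geodesics of `g`. -/
def Metric.IsProjectiveVectorField (g : Metric n M) (v : ∀ x : M, TangentSpace (𝓡 n) x) : Prop :=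
  IsSmoothVectorField v ∧
  ∀ p : M, ∃ (U : Set M) (ε : ℝ) (φ : ℝ → M → M), IsOpen U ∧ p ∈ U ∧ 0 < ε ∧
    IsLocalFlow v ε U φ ∧
    ∀ t ∈ Ioo (-ε) ε, ∀ (I : Set ℝ) (γ : ℝ → M), IsOpen I → I.OrdConnected →
      MapsTo γ I U → g.IsGeodesic I γ → g.IsGeodesic I (fun s => φ t (γ s))

/-! ### Benenti tensor, action matrix, Solodovnikov's polynomial -/

/-- The matrix of the Benenti tensor `L(g, g') = |det g' / det g|^{1/(n+1)} g'⁻¹ g`, as an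
endomorphism of `T_x M`, in the basis `fibreVec x`. -/
def benenti (g g' : Metric n M) (x : M) : Matrix (Fin n) (Fin n) ℝ :=
  |(g'.gram x).det / (g.gram x).det| ^ (1 / ((n : ℝ) + 1)) • ((g'.gram x)⁻¹ * g.gram x)

/-- `μ` is an eigenvalue (in `𝕜 = ℝ` or `ℂ`) of the Benenti tensor at `x`. -/
def IsBenentiEigenvalue {𝕜 : Type*} [RCLike 𝕜] (g g' : Metric n M) (x : M) (μ : 𝕜) : Prop :=
  Module.End.HasEigenvalue
    (Matrix.toLin' ((benenti g g' x).map (algebraMap ℝ 𝕜)) : Module.End 𝕜 (Fin n → 𝕜)) μ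

/-- `A = (a b; c d)` describes the action of `v` on the span of `σ, σ'`:
`ℒ_v σ = a σ + b σ'` and `ℒ_v σ' = c σ + d σ'`. -/
def IsActionMatrix (v : ∀ x : M, TangentSpace (𝓡 n) x) (σ σ' : WeightedField n M)
    (A : Matrix (Fin 2) (Fin 2) ℝ) : Prop :=
  ∀ e ∈ charts n M, ∀ y ∈ e.target,
    lieDeriv (vecComp v e) (WeightedField.comp σ e) y
        = A 0 0 • WeightedField.comp σ e y + A 0 1 • WeightedField.comp σ' e y ∧
    lieDeriv (vecComp v e) (WeightedField.comp σ' e) y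
        = A 1 0 • WeightedField.comp σ e y + A 1 1 • WeightedField.comp σ' e y

/-- Solodovnikov's polynomial `S_A(t) = -b t² + (d - a) t + c`. -/
def solodovnikov (A : Matrix (Fin 2) (Fin 2) ℝ) : Polynomial ℝ :=
  -(Polynomial.C (A 0 1) * Polynomial.X ^ 2)
    + Polynomial.C (A 1 1 - A 0 0) * Polynomial.X + Polynomial.C (A 1 0)

end Manifold

end ProjGeom

end

/-! Existence and uniqueness of `A`. A `(1,2)`-tensor `B`, symmetric below, with `B(u,u)` parallel
to `u` for all `u` is pure trace: `B^k_{ij} = δ^k_i ψ_j + δ^k_j ψ_i`. Since a geodesic leaves every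
point in every direction, this applies to the difference of the Levi-Civita connections of `g` and
`ḡ`, and, after differentiating the flow of `v` at time zero, to the Lie derivative `ℒ_v ∇`. The
weight of `σ` is chosen so that a pure-trace change of connection alters `∇σ` only by terms `δ^c_a
μ^b + δ^b_a μ^c`, which the metrisability system ignores. As `σ_ḡ` is parallel for `ḡ`, it solves
the system of `g` (`ProjectivelyEquivalent.sigma_mem_solSpace`); as `ℒ_v` commutes with `∇` up to
`ℒ_v ∇`, it preserves the solution space (`lieField_mem_solSpace`). Non-proportional metrics give
independent solutions (`sigma_linearIndependent`), so in mobility two `σ, σ̄` form a basis and `A`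
is the matrix of `ℒ_v` in it.

The eigenvalue equation. From `σ̄ = L σ` one finds formally `ℒ_v L = (c + d L) - L (a + b L) =
S_A(L)`. To pass to eigenvalues without assuming that they are simple or that `L` is diagonalisable,
the pencil `r₁ σ + r₂ σ̄` is transported along one integral curve of `v`. If the row `r` solves `r'
= -r A`, the matrix `K = r₁ σ + r₂ σ̄` satisfies `K' = C K + K Cᵀ - ½ tr(C) K` with `C` the Jacobian
of `v`, hence `(det K)' = ½ tr(C) det K`, and a singular `K` stays singular
(`det_pencil_transport`). An eigenvalue `λ(t)` is the singular member `(-λ(t), 1)`; carried back to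
time zero it becomes a singular member of a fixed pencil, which has only finitely many up to scale.
By continuity its ratio does not move, and differentiating this at `t = 0` gives `λ' = S_A(λ)`
(`deriv_pencil_root`). -/

noncomputable section

namespace ProjGeom

/-! ### Directional derivatives -/

/-- `f` is differentiable at `p` and its derivative in the direction `w` is `f'`. -/
def HasDirDeriv {F R : Type*} [NormedAddCommGroup F] [NormedSpace ℝ F] [NormedAddCommGroup R]
    [NormedSpace ℝ R] (f : F → R) (w : F) (f' : R) (p : F) : Prop :=
  ∃ L : F →L[ℝ] R, HasFDerivAt f L p ∧ L w = f'

section DirDeriv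

variable {F : Type*} [NormedAddCommGroup F] [NormedSpace ℝ F]
variable {R : Type*} [NormedCommRing R] [NormedAlgebra ℝ R]
variable {f h : F → R} {w p : F} {f' h' : R}

theorem HasDirDeriv.fderiv_eq (hf : HasDirDeriv f w f' p) : fderiv ℝ f p w = f' := by
  obtain ⟨L, hL, rfl⟩ := hf
  rw [hL.fderiv]

theorem HasDirDeriv.differentiableAt (hf : HasDirDeriv f w f' p) : DifferentiableAt ℝ f p := by
  obtain ⟨L, hL, rfl⟩ := hf
  exact hL.differentiableAt

theorem HasDirDeriv.congr (hf : HasDirDeriv f w f' p) (e : f' = h') : HasDirDeriv f w h' p :=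
  e ▸ hf

theorem HasDirDeriv.unique (hf : HasDirDeriv f w f' p) (hf' : HasDirDeriv f w h' p) : f' = h' := by
  rw [← hf.fderiv_eq, hf'.fderiv_eq]

theorem _root_.DifferentiableAt.hasDirDeriv (hf : DifferentiableAt ℝ f p) (w : F) :
    HasDirDeriv f w (fderiv ℝ f p w) p :=
  ⟨_, hf.hasFDerivAt, rfl⟩

theorem HasDirDeriv.congr_of_eventuallyEq (hf : HasDirDeriv f w f' p)
    (e : h =ᶠ[nhds p] f) : HasDirDeriv h w f' p := by
  obtain ⟨L, hL, rfl⟩ := hf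
  exact ⟨L, hL.congr_of_eventuallyEq e, rfl⟩

theorem HasDirDeriv.add (hf : HasDirDeriv f w f' p) (hh : HasDirDeriv h w h' p) :
    HasDirDeriv (fun z => f z + h z) w (f' + h') p := by
  obtain ⟨L, hL, rfl⟩ := hf
  obtain ⟨L', hL', rfl⟩ := hh
  exact ⟨_, hL.add hL', rfl⟩

theorem HasDirDeriv.sub (hf : HasDirDeriv f w f' p) (hh : HasDirDeriv h w h' p) :
    HasDirDeriv (fun z => f z - h z) w (f' - h') p := by
  obtain ⟨L, hL, rfl⟩ := hf
  obtain ⟨L', hL', rfl⟩ := hh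
  exact ⟨_, hL.sub hL', rfl⟩

theorem HasDirDeriv.mul (hf : HasDirDeriv f w f' p) (hh : HasDirDeriv h w h' p) :
    HasDirDeriv (fun z => f z * h z) w (f' * h p + f p * h') p := by
  obtain ⟨L, hL, rfl⟩ := hf
  obtain ⟨L', hL', rfl⟩ := hh
  exact ⟨_, hL.mul hL', by simp [mul_comm, add_comm]⟩

theorem HasDirDeriv.const (c : R) : HasDirDeriv (fun _ : F => c) w 0 p :=
  ⟨0, hasFDerivAt_const c p, rfl⟩

theorem HasDirDeriv.const_mul (c : R) (hf : HasDirDeriv f w f' p) :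
    HasDirDeriv (fun z => c * f z) w (c * f') p :=
  ((HasDirDeriv.const c).mul hf).congr (by ring)

theorem HasDirDeriv.sum {ι : Type*} {s : Finset ι} {f : ι → F → R} {f' : ι → R}
    (hf : ∀ i ∈ s, HasDirDeriv (f i) w (f' i) p) :
    HasDirDeriv (fun z => ∑ i ∈ s, f i z) w (∑ i ∈ s, f' i) p := by
  classical
  induction s using Finset.induction_on with
  | empty => simpa using HasDirDeriv.const 0
  | insert a s ha ih =>
    simp only [Finset.sum_insert ha]
    exact (hf a (Finset.mem_insert_self a s)).add
      (ih fun i hi => hf i (Finset.mem_insert_of_mem hi))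

/-- Entrywise directional derivative of a matrix-valued function. -/
def HasMatDeriv {m n : Type*} (T : F → Matrix m n R) (w : F) (T' : Matrix m n R) (p : F) : Prop :=
  ∀ i j, HasDirDeriv (fun z => T z i j) w (T' i j) p

theorem HasMatDeriv.add {m n : Type*} {T S : F → Matrix m n R} {T' S' : Matrix m n R}
    (hT : HasMatDeriv T w T' p) (hS : HasMatDeriv S w S' p) :
    HasMatDeriv (fun z => T z + S z) w (T' + S') p := fun i j => (hT i j).add (hS i j)

theorem HasMatDeriv.smul {m n : Type*} {S : F → Matrix m n R} {S' : Matrix m n R}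
    (hf : HasDirDeriv f w f' p) (hS : HasMatDeriv S w S' p) :
    HasMatDeriv (fun z => f z • S z) w (f' • S p + f p • S') p := fun i j => hf.mul (hS i j)

theorem HasMatDeriv.mul {l m n : Type*} [Fintype m] {T : F → Matrix l m R} {S : F → Matrix m n R}
    {T' : Matrix l m R} {S' : Matrix m n R}
    (hT : HasMatDeriv T w T' p) (hS : HasMatDeriv S w S' p) :
    HasMatDeriv (fun z => T z * S z) w (T' * S p + T p * S') p := fun i j => by
  simp only [Matrix.mul_apply, Matrix.add_apply, ← Finset.sum_add_distrib]
  exact HasDirDeriv.sum fun k _ => (hT i k).mul (hS k j)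

theorem HasMatDeriv.transpose {m n : Type*} {T : F → Matrix m n R} {T' : Matrix m n R}
    (hT : HasMatDeriv T w T' p) : HasMatDeriv (fun z => (T z).transpose) w T'.transpose p :=
  fun i j => hT j i

theorem HasMatDeriv.const {m n : Type*} (T : Matrix m n R) :
    HasMatDeriv (fun _ : F => T) w 0 p := fun i j => HasDirDeriv.const (T i j)

theorem HasMatDeriv.unique {m n : Type*} {T : F → Matrix m n R} {T' T'' : Matrix m n R}
    (hT : HasMatDeriv T w T' p) (hT' : HasMatDeriv T w T'' p) : T' = T'' := by
  ext i j
  exact (hT i j).unique (hT' i j)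

theorem HasMatDeriv.congr_of_eventuallyEq {m n : Type*} {T S : F → Matrix m n R}
    {T' : Matrix m n R} (hT : HasMatDeriv T w T' p) (e : S =ᶠ[nhds p] T) :
    HasMatDeriv S w T' p := fun i j =>
  (hT i j).congr_of_eventuallyEq (e.mono fun z hz => by simp only [hz])

/-- Jacobi's formula for `3 × 3` matrices. -/
theorem HasMatDeriv.det {T : F → Matrix (Fin 3) (Fin 3) R} {T' : Matrix (Fin 3) (Fin 3) R}
    (hT : HasMatDeriv T w T' p) :
    HasDirDeriv (fun z => (T z).det) w ((T p).adjugate * T').trace p := by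
  simp only [Matrix.det_fin_three]
  refine ((((((((hT 0 0).mul (hT 1 1)).mul (hT 2 2)).sub
    (((hT 0 0).mul (hT 1 2)).mul (hT 2 1))).sub
    (((hT 0 1).mul (hT 1 0)).mul (hT 2 2))).add
    (((hT 0 1).mul (hT 1 2)).mul (hT 2 0))).add
    (((hT 0 2).mul (hT 1 0)).mul (hT 2 1))).sub
    (((hT 0 2).mul (hT 1 1)).mul (hT 2 0))).congr ?_
  simp only [Matrix.trace_fin_three, Matrix.adjugate_fin_three, Matrix.mul_apply,
    Fin.sum_univ_three, Matrix.of_apply, Matrix.cons_val', Matrix.cons_val]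
  ring

end DirDeriv

/-! ### Derivatives of powers of determinants and of inverse matrices -/

section RealDirDeriv

variable {F : Type*} [NormedAddCommGroup F] [NormedSpace ℝ F] {w p : F}

theorem HasDirDeriv.abs_rpow {f : F → ℝ} {f' : ℝ} (hf : HasDirDeriv f w f' p) (h0 : f p ≠ 0)
    (r : ℝ) : HasDirDeriv (fun z => |f z| ^ r) w (r * |f p| ^ r * (f' / f p)) p := by
  obtain ⟨L, hL, rfl⟩ := hf
  have h1 := hL.abs h0
  have h2 := h1.rpow_const (p := r) (Or.inl (abs_ne_zero.mpr h0))
  refine ⟨_, h2, ?_⟩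
  have h3 : (SignType.sign (f p) : ℝ) = |f p| / f p := by
    rcases lt_or_gt_of_ne h0 with h | h
    · rw [sign_neg h, abs_of_neg h]; field_simp; simp
    · rw [sign_pos h, abs_of_pos h]; field_simp; simp
  have h4 : |f p| ^ r = |f p| ^ (r - 1) * |f p| := by
    rw [Real.rpow_sub_one (abs_ne_zero.mpr h0)]
    field_simp
  simp only [smul_apply, smul_eq_mul]
  rw [h4, h3]
  ring

theorem HasMatDeriv.abs_det_rpow {T : F → Matrix (Fin 3) (Fin 3) ℝ}
    {T' : Matrix (Fin 3) (Fin 3) ℝ} (hT : HasMatDeriv T w T' p) (h0 : (T p).det ≠ 0) (r : ℝ) :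
    HasDirDeriv (fun z => |(T z).det| ^ r) w
      (r * |(T p).det| ^ r * ((T p)⁻¹ * T').trace) p := by
  refine (hT.det.abs_rpow h0 r).congr ?_
  rw [Matrix.inv_def, Matrix.smul_mul, Matrix.trace_smul, Ring.inverse_eq_inv', smul_eq_mul,
    div_eq_inv_mul]

/-- Cramer's rule gives differentiability of the entries. The value then comes from differentiating
`T T⁻¹ = 1`, which holds near `p` because the determinant stays nonzero there. -/
theorem HasMatDeriv.inv {T : F → Matrix (Fin 3) (Fin 3) ℝ}
    {T' : Matrix (Fin 3) (Fin 3) ℝ} (hT : HasMatDeriv T w T' p) (h0 : (T p).det ≠ 0) :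
    HasMatDeriv (fun z => (T z)⁻¹) w (-((T p)⁻¹ * T' * (T p)⁻¹)) p := by
  have hdiff : ∀ i j, DifferentiableAt ℝ (fun z => (T z)⁻¹ i j) p := by
    intro i j
    have hd : DifferentiableAt ℝ (fun z => ((T z).det)⁻¹) p :=
      hT.det.differentiableAt.inv h0
    have ht : ∀ i j, DifferentiableAt ℝ (fun z => T z i j) p :=
      fun i j => (hT i j).differentiableAt
    simp only [Matrix.inv_def, Ring.inverse_eq_inv', Matrix.adjugate_fin_three]
    refine hd.mul ?_
    fin_cases i <;> fin_cases j <;>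
      simp only [Fin.zero_eta, Fin.mk_one, Fin.reduceFinMk, Matrix.of_apply, Matrix.cons_val',
        Matrix.cons_val] <;> fun_prop (disch := exact ht _ _)
  set P' : Matrix (Fin 3) (Fin 3) ℝ := Matrix.of fun i j => fderiv ℝ (fun z => (T z)⁻¹ i j) p w
  have hP : HasMatDeriv (fun z => (T z)⁻¹) w P' p := fun i j => (hdiff i j).hasDirDeriv w
  have hev : (fun _ => (1 : Matrix (Fin 3) (Fin 3) ℝ)) =ᶠ[nhds p] fun z => T z * (T z)⁻¹ := by
    filter_upwards [hT.det.differentiableAt.continuousAt.eventually_ne h0] with z hz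
    exact (Matrix.mul_nonsing_inv _ (isUnit_iff_ne_zero.mpr hz)).symm
  have h1 := (HasMatDeriv.const (F := F) (w := w) (p := p) (1 : Matrix (Fin 3) (Fin 3) ℝ)).unique
    ((hT.mul hP).congr_of_eventuallyEq hev)
  have h2 : P' = -((T p)⁻¹ * T' * (T p)⁻¹) := by
    have h3 : T p * P' = -(T' * (T p)⁻¹) := by
      rw [eq_neg_iff_add_eq_zero, add_comm]; exact h1.symm
    calc P' = (T p)⁻¹ * (T p * P') := by
          rw [← Matrix.mul_assoc, Matrix.nonsing_inv_mul _ (isUnit_iff_ne_zero.mpr h0),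
            Matrix.one_mul]
      _ = _ := by rw [h3, Matrix.mul_neg, Matrix.mul_assoc]
  exact h2 ▸ hP

end RealDirDeriv

/-! ### Partial derivatives -/

section Pd

variable {n : ℕ}

theorem sum_smul_stdVec (u : E n) : ∑ c, u c • stdVec c = u := by
  ext i
  simp [stdVec, Finset.sum_apply, Pi.single_apply]

theorem clm_apply_eq_sum {R : Type*} [NormedAddCommGroup R] [NormedSpace ℝ R] (L : E n →L[ℝ] R)
    (u : E n) : L u = ∑ c, u c • L (stdVec c) := by
  conv_lhs => rw [← sum_smul_stdVec u]
  simp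

theorem fderiv_eq_sum_pd (f : E n → ℝ) (y u : E n) :
    fderiv ℝ f y u = ∑ c, pd f c y * u c := by
  rw [clm_apply_eq_sum]
  simp [pd, mul_comm]

theorem hasDirDeriv_pd {f : E n → ℝ} {y : E n} (hf : DifferentiableAt ℝ f y) (i : Fin n) :
    HasDirDeriv f (stdVec i) (pd f i y) y := hf.hasDirDeriv _

theorem HasDirDeriv.pd_eq {f : E n → ℝ} {y : E n} {i : Fin n} {f' : ℝ}
    (hf : HasDirDeriv f (stdVec i) f' y) : pd f i y = f' := hf.fderiv_eq

theorem pd_congr {f h : E n → ℝ} {y : E n} (e : f =ᶠ[nhds y] h) (i : Fin n) :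
    pd f i y = pd h i y := by
  simp only [pd, e.fderiv_eq]

theorem contDiffOn_pd {f : E n → ℝ} {Ω : Set (E n)} (hΩ : IsOpen Ω) (hf : ContDiffOn ℝ ∞ f Ω)
    (i : Fin n) : ContDiffOn ℝ ∞ (pd f i) Ω :=
  (hf.fderiv_of_isOpen hΩ (m := ∞) (by simp)).clm_apply contDiffOn_const

/-- Stated over a general normed space because it serves both on `E n` and on `ℝ × E n`, where it
exchanges time and space derivatives of a flow. -/
theorem fderiv_fderiv_comm {F : Type*} [NormedAddCommGroup F] [NormedSpace ℝ F] {f : F → ℝ} {p : F}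
    (hf : ContDiffAt ℝ 2 f p) (u w : F) :
    fderiv ℝ (fun q => fderiv ℝ f q u) p w = fderiv ℝ (fun q => fderiv ℝ f q w) p u := by
  have hd : DifferentiableAt ℝ (fderiv ℝ f) p :=
    (hf.fderiv_right (m := 1) (by norm_num)).differentiableAt (by norm_num)
  have h := hf.isSymmSndFDerivAt (by simp)
  have key : ∀ u w, fderiv ℝ (fun q => fderiv ℝ f q u) p w = fderiv ℝ (fderiv ℝ f) p w u := by
    intro u w
    rw [fderiv_clm_apply hd (by fun_prop)]
    simp
  rw [key, key, h.eq]

theorem pd_comm {f : E n → ℝ} {y : E n} (hf : ContDiffAt ℝ 2 f y) (i j : Fin n) :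
    pd (pd f i) j y = pd (pd f j) i y := fderiv_fderiv_comm hf _ _

/-- The Jacobian matrix of a map of (open subsets of) `ℝⁿ`. -/
def jacMat (τ : E n → E n) (y : E n) : Matrix (Fin n) (Fin n) ℝ :=
  Matrix.of fun i j => pd (fun z => τ z i) j y

/-- The matrix of `a`-th partial derivatives of the entries. -/
def pdMat (T : E n → Matrix (Fin n) (Fin n) ℝ) (a : Fin n) (y : E n) : Matrix (Fin n) (Fin n) ℝ :=
  Matrix.of fun i j => pd (fun z => T z i j) a y

theorem hasMatDeriv_pdMat {T : E n → Matrix (Fin n) (Fin n) ℝ} {y : E n}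
    (hT : ∀ i j, DifferentiableAt ℝ (fun z => T z i j) y) (a : Fin n) :
    HasMatDeriv T (stdVec a) (pdMat T a y) y := fun i j => hasDirDeriv_pd (hT i j) a

theorem fderiv_coord {F : Type*} [NormedAddCommGroup F] [NormedSpace ℝ F] {τ : F → E n} {p : F}
    (hτ : DifferentiableAt ℝ τ p) (w : F) (i : Fin n) :
    fderiv ℝ (fun z => τ z i) p w = fderiv ℝ τ p w i := by
  have h : HasFDerivAt (fun z => τ z i) ((EuclideanSpace.proj (𝕜 := ℝ) i).comp (fderiv ℝ τ p)) p :=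
    ((EuclideanSpace.proj (𝕜 := ℝ) i).hasFDerivAt (x := τ p)).comp p hτ.hasFDerivAt
  rw [h.fderiv]
  rfl

theorem differentiableAt_coord {F : Type*} [NormedAddCommGroup F] [NormedSpace ℝ F] {τ : F → E n}
    {p : F} (hτ : DifferentiableAt ℝ τ p) (i : Fin n) :
    DifferentiableAt ℝ (fun z => τ z i) p :=
  ((EuclideanSpace.proj (𝕜 := ℝ) i).differentiableAt).comp p hτ

theorem fderiv_apply_eq_jacMat {τ : E n → E n} {y : E n} (hτ : DifferentiableAt ℝ τ y) (u : E n)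
    (i : Fin n) : fderiv ℝ τ y u i = ∑ j, jacMat τ y i j * u j := by
  rw [← fderiv_coord hτ, fderiv_eq_sum_pd]
  rfl

theorem hasDirDeriv_comp {F : Type*} [NormedAddCommGroup F] [NormedSpace ℝ F]
    {f : E n → ℝ} {τ : F → E n} {p w : F}
    (hf : DifferentiableAt ℝ f (τ p)) (hτ : DifferentiableAt ℝ τ p) :
    HasDirDeriv (fun z => f (τ z)) w (∑ c, pd f c (τ p) * fderiv ℝ (fun z => τ z c) p w) p := by
  refine ⟨_, hf.hasFDerivAt.comp p hτ.hasFDerivAt, ?_⟩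
  simp only [ContinuousLinearMap.comp_apply]
  rw [fderiv_eq_sum_pd]
  simp only [fderiv_coord hτ]

end Pd

/-! ### The Levi-Civita connection in coordinates -/

section Christoffel

variable {n : ℕ} {G : E n → Matrix (Fin n) (Fin n) ℝ} {y : E n}

theorem christoffel_symm (hs : ∀ z, (G z).IsSymm) (k i j : Fin n) :
    christoffel G y k i j = christoffel G y k j i := by
  have h : ∀ i j, (fun z => G z i j) = fun z => G z j i := fun i j => by
    funext z; exact (hs z).apply j i
  simp only [christoffel, h i j]
  congr 1
  exact Finset.sum_congr rfl fun h _ => by ring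

theorem sum_mul_christoffel (h0 : (G y).det ≠ 0) (h i j : Fin n) :
    ∑ k, G y h k * christoffel G y k i j = (1 / 2) *
      (pd (fun z => G z j h) i y + pd (fun z => G z i h) j y - pd (fun z => G z i j) h y) := by
  set Q : Fin n → ℝ := fun h =>
    pd (fun z => G z j h) i y + pd (fun z => G z i h) j y - pd (fun z => G z i j) h y with hQ
  have e : ∀ k, christoffel G y k i j = (1 / 2) * ((G y)⁻¹.mulVec Q) k := fun k => rfl
  have : ∑ k, G y h k * christoffel G y k i j = (1 / 2) * ((G y).mulVec ((G y)⁻¹.mulVec Q)) h := by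
    simp only [e, Matrix.mulVec, dotProduct, Finset.mul_sum]
    exact Finset.sum_congr rfl fun k _ => Finset.sum_congr rfl fun l _ => by ring
  rw [this, Matrix.mulVec_mulVec, Matrix.mul_nonsing_inv _ (isUnit_iff_ne_zero.mpr h0),
    Matrix.one_mulVec]

/-- The connection matrix `(Γ^b_{ad})_{bd}`. -/
def connMat (G : E n → Matrix (Fin n) (Fin n) ℝ) (a : Fin n) (y : E n) :
    Matrix (Fin n) (Fin n) ℝ :=
  Matrix.of fun b d => christoffel G y b a d

/-- This is `∇g = 0` in matrix form: in the sum of the two lowered Christoffel symbols all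
derivatives but `g_{ij,a}` cancel. -/
theorem pdMat_metric (hs : ∀ z, (G z).IsSymm) (h0 : (G y).det ≠ 0) (a : Fin n) :
    pdMat G a y = G y * connMat G a y + (connMat G a y).transpose * G y := by
  have h : ∀ i j, (fun z => G z i j) = fun z => G z j i := fun i j => by
    funext z; exact (hs z).apply j i
  ext i j
  have h1 := sum_mul_christoffel h0 j a i
  have h2 := sum_mul_christoffel h0 i a j
  simp only [pdMat, connMat, Matrix.add_apply, Matrix.mul_apply, Matrix.of_apply,
    Matrix.transpose_apply]
  have h3 : ∑ x, christoffel G y x a i * G y x j = ∑ x, G y j x * christoffel G y x a i :=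
    Finset.sum_congr rfl fun x _ => by rw [(hs y).apply j x, mul_comm]
  rw [h3, h1, h2, h j i]
  ring

theorem covDeriv_congr {S S' : E n → Matrix (Fin n) (Fin n) ℝ} (e : S =ᶠ[nhds y] S')
    (a b c : Fin n) : covDeriv G S y a b c = covDeriv G S' y a b c := by
  have h : ∀ b c, (fun z => S z b c) =ᶠ[nhds y] fun z => S' z b c := fun b c =>
    e.mono fun z hz => by simp only [hz]
  simp only [covDeriv, pd_congr (h b c), e.eq_of_nhds]

/-- `|det g|^{1/4} g⁻¹` is parallel for the Levi-Civita connection of `g`. -/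
theorem covDeriv_sigma {G : E 3 → Matrix (Fin 3) (Fin 3) ℝ} {y : E 3}
    (hd : ∀ i j, DifferentiableAt ℝ (fun z => G z i j) y) (hs : ∀ z, (G z).IsSymm)
    (h0 : (G y).det ≠ 0) (a b c : Fin 3) :
    covDeriv G (fun z => |(G z).det| ^ (1 / ((3 : ℕ) + 1) : ℝ) • (G z)⁻¹) y a b c = 0 := by
  have hu : IsUnit (G y).det := isUnit_iff_ne_zero.mpr h0
  have hG := hasMatDeriv_pdMat hd a
  have h1 := HasMatDeriv.smul (hG.abs_det_rpow h0 (1 / ((3 : ℕ) + 1) : ℝ)) (hG.inv h0) b c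
  -- The factor `2` here times the exponent `1/4` is the `2/(3+1)` of the density term in
  -- `covDeriv`, so the two traces cancel; `hinv` likewise cancels the two index terms.
  have htr : ((G y)⁻¹ * pdMat G a y).trace = 2 * (connMat G a y).trace := by
    rw [pdMat_metric hs h0, Matrix.mul_add, Matrix.trace_add, ← Matrix.mul_assoc,
      Matrix.nonsing_inv_mul _ hu, Matrix.one_mul, ← Matrix.mul_assoc, Matrix.trace_mul_comm,
      ← Matrix.mul_assoc, Matrix.mul_nonsing_inv _ hu, Matrix.one_mul, Matrix.trace_transpose]
    ring
  have hinv : (G y)⁻¹ * pdMat G a y * (G y)⁻¹ =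
      connMat G a y * (G y)⁻¹ + (G y)⁻¹ * (connMat G a y).transpose := by
    rw [pdMat_metric hs h0, Matrix.mul_add, ← Matrix.mul_assoc, Matrix.nonsing_inv_mul _ hu,
      Matrix.one_mul, Matrix.add_mul, Matrix.mul_assoc (G y)⁻¹, Matrix.mul_assoc _ (G y),
      Matrix.mul_nonsing_inv _ hu, Matrix.mul_one]
  rw [htr, hinv] at h1
  have hsi : ∀ d b, (G y)⁻¹ d b = (G y)⁻¹ b d := fun d b => by
    have : ((G y)⁻¹).transpose = (G y)⁻¹ := by
      rw [Matrix.transpose_nonsing_inv, (hs y).eq]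
    exact congrFun (congrFun this b) d
  have htr' : ∑ d, christoffel G y d d a = (connMat G a y).trace := by
    simp only [Matrix.trace, Matrix.diag, connMat, Matrix.of_apply]
    exact Finset.sum_congr rfl fun d _ => christoffel_symm hs d d a
  have e1 : ∑ d, christoffel G y b a d * (G y)⁻¹ d c = (connMat G a y * (G y)⁻¹) b c := rfl
  have e2 : ∑ d, christoffel G y c a d * (G y)⁻¹ d b
      = ((G y)⁻¹ * (connMat G a y).transpose) b c := by
    simp only [Matrix.mul_apply, Matrix.transpose_apply, connMat, Matrix.of_apply]
    exact Finset.sum_congr rfl fun d _ => by rw [hsi d b, mul_comm]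
  have e3 := h1.pd_eq
  simp only [covDeriv, e3, htr']
  simp only [Matrix.smul_apply, smul_eq_mul, Matrix.add_apply, Matrix.neg_apply,
    mul_left_comm _ (|(G y).det| ^ (1 / (((3 : ℕ) : ℝ) + 1))), ← Finset.mul_sum]
  rw [e1, e2]
  push_cast
  ring

end Christoffel

/-! ### Behaviour under coordinate changes -/

section Transform

variable {τ : E 3 → E 3} {y : E 3}

theorem contDiffAt_coord {m : ℕ∞ω} {F : Type*} [NormedAddCommGroup F] [NormedSpace ℝ F]
    {τ : F → E 3} {p : F} (hτ : ContDiffAt ℝ m τ p) (i : Fin 3) :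
    ContDiffAt ℝ m (fun z => τ z i) p :=
  (EuclideanSpace.proj (𝕜 := ℝ) i).contDiff.contDiffAt.comp p hτ

theorem differentiableAt_pd {n : ℕ} {f : E n → ℝ} {y : E n} (hf : ContDiffAt ℝ 2 f y) (i : Fin n) :
    DifferentiableAt ℝ (pd f i) y :=
  ((hf.fderiv_right (m := 1) (by norm_num)).differentiableAt (by norm_num)).clm_apply
    (differentiableAt_const _)

theorem differentiableAt_jacMat (hτ : ContDiffAt ℝ 2 τ y) (i j : Fin 3) :
    DifferentiableAt ℝ (fun z => jacMat τ z i j) y :=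
  differentiableAt_pd (contDiffAt_coord hτ i) j

theorem pd_jacMat_comm (hτ : ContDiffAt ℝ 2 τ y) (m i j : Fin 3) :
    pd (fun z => jacMat τ z m i) j y = pd (fun z => jacMat τ z m j) i y :=
  pd_comm (contDiffAt_coord hτ m) i j

/-- The transformation law of the Christoffel symbols. -/
theorem christoffel_transform {G G' : E 3 → Matrix (Fin 3) (Fin 3) ℝ}
    (hτ : ContDiffAt ℝ 2 τ y) (hT : (jacMat τ y).det ≠ 0)
    (hG' : ∀ i j, DifferentiableAt ℝ (fun z => G' z i j) (τ y)) (hs : ∀ z, (G' z).IsSymm)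
    (h0 : (G' (τ y)).det ≠ 0)
    (hG : ∀ᶠ z in nhds y, G z = (jacMat τ z).transpose * G' (τ z) * jacMat τ z) (m i j : Fin 3) :
    ∑ k, jacMat τ y m k * christoffel G y k i j = pd (fun z => jacMat τ z m j) i y
      + ∑ a, ∑ b, christoffel G' (τ y) m a b * jacMat τ y a i * jacMat τ y b j := by
  set T := jacMat τ y with hTdef
  have hτd : DifferentiableAt ℝ τ y := hτ.differentiableAt (by norm_num)
  have hGe : ∀ i j, (fun z => G z i j) =ᶠ[nhds y] fun z =>
      ∑ a, ∑ b, jacMat τ z b i * G' (τ z) b a * jacMat τ z a j := fun i j => hG.mono fun z hz => by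
    simp only [hz, Matrix.mul_apply, Matrix.transpose_apply, Finset.sum_mul]
  have hdG : ∀ i j k, pd (fun z => G z i j) k y = ∑ a, ∑ b,
      ((pd (fun z => jacMat τ z b i) k y * G' (τ y) b a
        + T b i * ∑ c, pd (fun z => G' z b a) c (τ y) * T c k) * T a j
        + T b i * G' (τ y) b a * pd (fun z => jacMat τ z a j) k y) := by
    intro i j k
    rw [pd_congr (hGe i j)]
    refine HasDirDeriv.pd_eq ?_
    exact HasDirDeriv.sum fun a _ => HasDirDeriv.sum fun b _ =>
      ((hasDirDeriv_pd (differentiableAt_jacMat hτ b i) k).mul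
        (hasDirDeriv_comp (hG' b a) hτd)).mul (hasDirDeriv_pd (differentiableAt_jacMat hτ a j) k)
  -- `R` is twice the right-hand side of the transformation law lowered with `G'`, and `Q` below is
  -- twice the Christoffel symbol of `G` with lowered index. The law reduces to `Q = Tᵀ R`, where
  -- the second derivatives of `τ` match by symmetry, together with `T G⁻¹ Tᵀ = G'⁻¹`.
  set R : Fin 3 → ℝ := fun c => 2 * ∑ d, G' (τ y) c d * pd (fun z => jacMat τ z d j) i y
    + ∑ a, ∑ b, (pd (fun z => G' z b c) a (τ y) + pd (fun z => G' z a c) b (τ y)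
        - pd (fun z => G' z a b) c (τ y)) * T a i * T b j with hR
  set Q : Fin 3 → ℝ := fun h =>
    pd (fun z => G z j h) i y + pd (fun z => G z i h) j y - pd (fun z => G z i j) h y with hQ
  have hQR : Q = T.transpose.mulVec R := by
    funext h
    have c1 : ∀ m, pd (fun z => jacMat τ z m i) h y = pd (fun z => jacMat τ z m h) i y :=
      fun m => pd_jacMat_comm hτ m i h
    have c2 : ∀ m, pd (fun z => jacMat τ z m j) h y = pd (fun z => jacMat τ z m h) j y :=
      fun m => pd_jacMat_comm hτ m j h
    have c3 : ∀ m, pd (fun z => jacMat τ z m i) j y = pd (fun z => jacMat τ z m j) i y :=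
      fun m => pd_jacMat_comm hτ m i j
    have s : ∀ a b, G' (τ y) a b = G' (τ y) b a := fun a b => (hs _).apply b a
    have s' : ∀ a b, (fun z => G' z a b) = fun z => G' z b a := fun a b => by
      funext z; exact (hs z).apply b a
    simp only [hQ, hR, hdG, Matrix.mulVec, dotProduct, Matrix.transpose_apply, c1, c2, c3,
      Fin.sum_univ_three, s 1 0, s 2 0, s 2 1, s' 1 0, s' 2 0, s' 2 1]
    ring
  have hu : IsUnit T.det := isUnit_iff_ne_zero.mpr hT
  have hinv : T * (G y)⁻¹ * T.transpose = (G' (τ y))⁻¹ := by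
    rw [hG.self_of_nhds, Matrix.mul_inv_rev, Matrix.mul_inv_rev, ← hTdef, ← Matrix.mul_assoc,
      ← Matrix.mul_assoc, Matrix.mul_nonsing_inv _ hu, Matrix.one_mul, Matrix.mul_assoc,
      Matrix.nonsing_inv_mul _ (by rwa [Matrix.det_transpose]), Matrix.mul_one]
  have e1 : ∑ k, T m k * christoffel G y k i j = (1 / 2) * (T.mulVec ((G y)⁻¹.mulVec Q)) m := by
    simp only [christoffel, hQ, Matrix.mulVec, dotProduct, Finset.mul_sum]
    exact Finset.sum_congr rfl fun k _ => Finset.sum_congr rfl fun l _ => by ring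
  have e2 : ((G' (τ y))⁻¹.mulVec R) m = 2 * pd (fun z => jacMat τ z m j) i y
      + 2 * ∑ a, ∑ b, christoffel G' (τ y) m a b * T a i * T b j := by
    have hR' : R = (2 : ℝ) • (G' (τ y)).mulVec (fun d => pd (fun z => jacMat τ z d j) i y)
      + fun c => ∑ a, ∑ b, (pd (fun z => G' z b c) a (τ y) + pd (fun z => G' z a c) b (τ y)
        - pd (fun z => G' z a b) c (τ y)) * T a i * T b j := by
      funext c
      simp [hR, Matrix.mulVec, dotProduct]
    rw [hR', Matrix.mulVec_add, Matrix.mulVec_smul, Matrix.mulVec_mulVec,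
      Matrix.nonsing_inv_mul _ (isUnit_iff_ne_zero.mpr h0), Matrix.one_mulVec]
    simp only [Pi.add_apply, Pi.smul_apply, smul_eq_mul, add_right_inj, christoffel, Matrix.mulVec,
      dotProduct, Fin.sum_univ_three]
    ring
  rw [e1, hQR, Matrix.mulVec_mulVec, Matrix.mulVec_mulVec, hinv, e2]
  ring

theorem lieDeriv_eq_matrix (V : E 3 → E 3) (S : E 3 → Matrix (Fin 3) (Fin 3) ℝ) (y : E 3) :
    lieDeriv V S y = (Matrix.of fun i j => fderiv ℝ (fun z => S z i j) y (V y))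
      - jacMat V y * S y - S y * (jacMat V y).transpose
      + ((1 / 2) * (jacMat V y).trace) • S y := by
  ext i j
  simp only [lieDeriv, Matrix.of_apply, Matrix.add_apply, Matrix.sub_apply, Matrix.mul_apply,
    Matrix.smul_apply, Matrix.trace, Matrix.diag, Matrix.transpose_apply, jacMat,
    fderiv_eq_sum_pd, smul_eq_mul, mul_comm (V y _)]
  norm_num [mul_comm]

/-- The Lie derivative is natural under coordinate changes. -/
theorem lieDeriv_transform {V V' : E 3 → E 3} {S S' : E 3 → Matrix (Fin 3) (Fin 3) ℝ}
    (hτ : ContDiffAt ℝ 2 τ y) (hT : (jacMat τ y).det ≠ 0)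
    (hV : DifferentiableAt ℝ V y) (hV' : DifferentiableAt ℝ V' (τ y))
    (hS : ∀ i j, DifferentiableAt ℝ (fun z => S z i j) y)
    (hS' : ∀ i j, DifferentiableAt ℝ (fun z => S' z i j) (τ y))
    (eV : ∀ᶠ z in nhds y, V' (τ z) = fderiv ℝ τ z (V z))
    (eS : ∀ᶠ z in nhds y, S' (τ z) = |(jacMat τ z).det| ^ (-(2 / (((3 : ℕ) : ℝ) + 1))) •
      (jacMat τ z * S z * (jacMat τ z).transpose)) :
    lieDeriv V' S' (τ y) = |(jacMat τ y).det| ^ (-(2 / (((3 : ℕ) : ℝ) + 1))) •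
      (jacMat τ y * lieDeriv V S y * (jacMat τ y).transpose) := by
  have hτd : DifferentiableAt ℝ τ y := hτ.differentiableAt (by norm_num)
  have hτe : ∀ᶠ z in nhds y, DifferentiableAt ℝ τ z :=
    (hτ.eventually (by simp)).mono fun z hz => hz.differentiableAt (by norm_num)
  set T := jacMat τ y with hTdef
  set DT : Matrix (Fin 3) (Fin 3) ℝ :=
    Matrix.of fun i j => fderiv ℝ (fun z => jacMat τ z i j) y (V y) with hDT
  set DS : Matrix (Fin 3) (Fin 3) ℝ := Matrix.of fun i j => fderiv ℝ (fun z => S z i j) y (V y)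
    with hDS
  have hTm : HasMatDeriv (jacMat τ) (V y) DT y :=
    fun i j => (differentiableAt_jacMat hτ i j).hasDirDeriv _
  have hSm : HasMatDeriv S (V y) DS y := fun i j => (hS i j).hasDirDeriv _
  have hu : IsUnit T.det := isUnit_iff_ne_zero.mpr hT
  -- the derivative of the transformed vector field
  have hW : jacMat V' (τ y) * T = DT + T * jacMat V y := by
    ext i j
    have h1 : HasDirDeriv (fun z => V' (τ z) i) (stdVec j)
        (∑ c, jacMat V' (τ y) i c * T c j) y :=
      hasDirDeriv_comp (f := fun x => V' x i) (differentiableAt_coord hV' i) hτd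
    have h2 : (fun z => V' (τ z) i) =ᶠ[nhds y] fun z => ∑ k, jacMat τ z i k * V z k := by
      filter_upwards [eV, hτe] with z hz hz'
      rw [hz, fderiv_apply_eq_jacMat hz']
    have h3 : HasDirDeriv (fun z => ∑ k, jacMat τ z i k * V z k) (stdVec j)
        (∑ k, (pd (fun z => jacMat τ z i k) j y * V y k + T i k * jacMat V y k j)) y :=
      HasDirDeriv.sum fun k _ => (hasDirDeriv_pd (differentiableAt_jacMat hτ i k) j).mul
        (hasDirDeriv_pd (differentiableAt_coord hV k) j)
    have h4 := h1.unique (h3.congr_of_eventuallyEq h2)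
    simp only [Matrix.mul_apply, Matrix.add_apply, h4, hDT, Matrix.of_apply, fderiv_eq_sum_pd,
      Finset.sum_add_distrib, pd_jacMat_comm hτ i j]
  have hVy : ∀ c, fderiv ℝ (fun z => τ z c) y (V y) = V' (τ y) c := fun c => by
    rw [eV.self_of_nhds, fderiv_coord hτd]
  have hS'm : HasMatDeriv (fun z => S' (τ z)) (V y)
      (Matrix.of fun i j => fderiv ℝ (fun z => S' z i j) (τ y) (V' (τ y))) y := fun i j => by
    refine (hasDirDeriv_comp (hS' i j) hτd).congr ?_
    simp only [hVy, Matrix.of_apply, fderiv_eq_sum_pd]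
  have hS'm' := (HasMatDeriv.smul (hTm.abs_det_rpow hT (-(2 / (((3 : ℕ) : ℝ) + 1))))
    ((hTm.mul hSm).mul hTm.transpose)).congr_of_eventuallyEq eS
  have hD := hS'm.unique hS'm'
  -- The extra trace, with the coefficient `1/2` of the divergence term, cancels the derivative of
  -- the weight `|det T|^{-1/2}`.
  have htrW : (jacMat V' (τ y)).trace = (T⁻¹ * DT).trace + (jacMat V y).trace := by
    have : jacMat V' (τ y) = (DT + T * jacMat V y) * T⁻¹ := by
      rw [← hW, Matrix.mul_assoc, Matrix.mul_nonsing_inv _ hu, Matrix.mul_one]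
    rw [this, Matrix.trace_mul_comm, Matrix.mul_add, ← Matrix.mul_assoc,
      Matrix.nonsing_inv_mul _ hu, Matrix.one_mul, Matrix.trace_add]
  rw [lieDeriv_eq_matrix, lieDeriv_eq_matrix, hD, htrW, eS.self_of_nhds, ← hTdef, ← hDS]
  set ρ := |T.det| ^ (-(2 / (((3 : ℕ) : ℝ) + 1)))
  have e1 : jacMat V' (τ y) * (ρ • (T * S y * T.transpose))
      = ρ • ((DT + T * jacMat V y) * S y * T.transpose) := by
    rw [← hW, Matrix.mul_smul]
    simp only [Matrix.mul_assoc]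
  have e2 : (ρ • (T * S y * T.transpose)) * (jacMat V' (τ y)).transpose
      = ρ • (T * S y * (DT + T * jacMat V y).transpose) := by
    rw [← hW, Matrix.smul_mul, Matrix.transpose_mul]
    simp only [Matrix.mul_assoc]
  rw [e1, e2]
  simp only [Matrix.transpose_add, Matrix.transpose_mul, Matrix.mul_add, Matrix.add_mul,
    Matrix.mul_sub, Matrix.sub_mul, Matrix.mul_assoc, Matrix.mul_smul, Matrix.smul_mul]
  push_cast
  module

end Transform

/-! ### Pure-trace tensors and the metrisability system -/

/-- `B^k_{ij} = δ^k_i ψ_j + δ^k_j ψ_i`. -/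
def IsPureTrace (B : Fin 3 → Fin 3 → Fin 3 → ℝ) (ψ : Fin 3 → ℝ) : Prop :=
  ∀ k i j, B k i j = (if k = i then ψ j else 0) + (if k = j then ψ i else 0)

/-- A symmetric `B` such that `B(u, u)` is always parallel to `u` is pure trace. -/
theorem exists_isPureTrace {B : Fin 3 → Fin 3 → Fin 3 → ℝ} (hs : ∀ k i j, B k i j = B k j i)
    (h : ∀ (u : E 3) (k l : Fin 3), u l * ∑ i, ∑ j, B k i j * u i * u j
      = u k * ∑ i, ∑ j, B l i j * u i * u j) : ∃ ψ, IsPureTrace B ψ := by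
  have key : ∀ x y z : ℝ, ∀ k l : Fin 3, _ := fun x y z k l => h !₂[x, y, z] k l
  simp only [Fin.sum_univ_three, hs _ 1 0, hs _ 2 0, hs _ 2 1, Matrix.cons_val] at key
  -- Basis vectors give `B^k_{ii} = 0` for `k ≠ i`. The vectors `e_i ± e_j` give `B^i_{ij} =
  -- B^j_{jj} / 2` and kill `B^k_{ij}` for distinct indices. Hence `ψ_i = B^i_{ii} / 2`.
  have a1 := key 1 0 0 1 0
  have a2 := key 1 0 0 2 0
  have a3 := key 0 1 0 0 1
  have a4 := key 0 1 0 2 1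
  have a5 := key 0 0 1 0 2
  have a6 := key 0 0 1 1 2
  have b1 := key 1 1 0 0 1
  have b2 := key 1 (-1) 0 0 1
  have b3 := key 1 1 0 0 2
  have c1 := key 1 0 1 0 2
  have c2 := key 1 0 (-1) 0 2
  have c3 := key 1 0 1 0 1
  have d1 := key 0 1 1 1 2
  have d2 := key 0 1 (-1) 1 2
  have d3 := key 0 1 1 1 0
  simp only [Matrix.cons_val] at a1 a2 a3 a4 a5 a6 b1 b2 b3 c1 c2 c3 d1 d2 d3
  ring_nf at a1 a2 a3 a4 a5 a6 b1 b2 b3 c1 c2 c3 d1 d2 d3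
  refine ⟨fun i => B i i i / 2, fun k i j => ?_⟩
  fin_cases k <;> fin_cases i <;> fin_cases j <;>
    simp [hs _ 1 0, hs _ 2 0, hs _ 2 1] <;> linarith

/-- Contracting `a` with `b` on the right returns `(3 + 1) μ^c`, so `μ` is forced to be a quarter of
the divergence. The form with an unspecified `μ` lets later proofs exhibit one instead of computing
a trace. -/
theorem linearSystemAt_iff {G S : E 3 → Matrix (Fin 3) (Fin 3) ℝ} {y : E 3} :
    LinearSystemAt G S y ↔ ∃ μ : Fin 3 → ℝ, ∀ a b c, covDeriv G S y a b c
      = (if c = a then μ b else 0) + (if b = a then μ c else 0) := by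
  constructor
  · intro h
    refine ⟨fun b => (1 / 4) * ∑ i, covDeriv G S y i i b, fun a b c => ?_⟩
    have := h a b c
    push_cast at this
    have e := sub_eq_zero.mp this
    rw [e]
    split_ifs <;> ring
  · rintro ⟨μ, h⟩ a b c
    simp only [h, Finset.sum_add_distrib]
    simp only [Finset.sum_ite_eq, Finset.sum_const, Finset.mem_univ, if_true, Finset.card_univ,
      Fintype.card_fin]
    split_ifs <;> norm_num <;> ring

/-- The metrisability system only depends on the projective class of the connection. -/
theorem linearSystemAt_of_parallel {G G' S : E 3 → Matrix (Fin 3) (Fin 3) ℝ} {y : E 3}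
    (hS : (S y).IsSymm) (h : ∀ a b c, covDeriv G' S y a b c = 0) {ψ : Fin 3 → ℝ}
    (hψ : IsPureTrace (fun k i j => christoffel G' y k i j - christoffel G y k i j) ψ) :
    LinearSystemAt G S y := by
  rw [linearSystemAt_iff]
  -- The terms `ψ_a σ^{bc}` cancel: the two indices contribute two of them, and the density term
  -- contributes `2/(3+1)` times `4` with the opposite sign. Only the Kronecker terms remain.
  refine ⟨fun c => -∑ d, ψ d * S y d c, fun a b c => ?_⟩
  have hc : ∀ k i j, christoffel G y k i j = christoffel G' y k i j
      - ((if k = i then ψ j else 0) + (if k = j then ψ i else 0)) := fun k i j => by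
    rw [← hψ k i j]; ring
  have h1 := h a b c
  have h2 : S y c b = S y b c := hS.apply b c
  simp only [covDeriv] at h1 ⊢
  simp only [hc, sub_mul, add_mul, Finset.sum_sub_distrib, Finset.sum_add_distrib, ite_mul,
    zero_mul, Finset.sum_ite_eq, Finset.mem_univ, if_true, Finset.sum_const, Finset.card_univ,
    Fintype.card_fin, Finset.sum_ite_eq', Finset.sum_ite_irrel]
  simp only [h2] at h1 ⊢
  push_cast at h1 ⊢
  split_ifs <;> simp only [nsmul_eq_mul] <;> push_cast <;> linear_combination h1

/-- The Lie derivative along `V` of the Levi-Civita connection of `G`. -/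
def lieConn (V : E 3 → E 3) (G : E 3 → Matrix (Fin 3) (Fin 3) ℝ) (y : E 3) (k i j : Fin 3) : ℝ :=
  pd (pd (fun z => V z k) j) i y + ∑ m, V y m * pd (fun z => christoffel G z k i j) m y
    - ∑ m, pd (fun z => V z k) m y * christoffel G y m i j
    + ∑ m, pd (fun z => V z m) i y * christoffel G y k m j
    + ∑ m, pd (fun z => V z m) j y * christoffel G y k i m

/-! ### Commuting the Lie derivative with the covariant derivative -/

section Commutation

variable {G S : E 3 → Matrix (Fin 3) (Fin 3) ℝ} {V : E 3 → E 3} {y : E 3}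

theorem hasDirDeriv_lieDeriv (hV : ∀ i, ContDiffAt ℝ 2 (fun z => V z i) y)
    (hS : ∀ i j, ContDiffAt ℝ 2 (fun z => S z i j) y) (i j a : Fin 3) :
    HasDirDeriv (fun z => lieDeriv V S z i j) (stdVec a)
      ((∑ k, (pd (fun z => V z k) a y * pd (fun z => S z i j) k y
          + V y k * pd (pd (fun z => S z i j) k) a y))
        - (∑ k, (pd (pd (fun z => V z i) k) a y * S y k j
          + pd (fun z => V z i) k y * pd (fun z => S z k j) a y))
        - (∑ k, (pd (pd (fun z => V z j) k) a y * S y i k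
          + pd (fun z => V z j) k y * pd (fun z => S z i k) a y))
        + ((2 / (((3 : ℕ) : ℝ) + 1)) * (∑ k, pd (pd (fun z => V z k) k) a y) * S y i j
          + (2 / (((3 : ℕ) : ℝ) + 1)) * (∑ k, pd (fun z => V z k) k y)
            * pd (fun z => S z i j) a y)) y := by
  have v := fun k => hasDirDeriv_pd ((hV k).differentiableAt (by norm_num)) a
  have dv := fun k l => hasDirDeriv_pd (differentiableAt_pd (hV k) l) a
  have s := fun k l => hasDirDeriv_pd ((hS k l).differentiableAt (by norm_num)) a
  have ds := fun k l m => hasDirDeriv_pd (differentiableAt_pd (hS k l) m) a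
  exact (((HasDirDeriv.sum fun k _ => (v k).mul (ds i j k)).sub
    (HasDirDeriv.sum fun k _ => (dv i k).mul (s k j))).sub
    (HasDirDeriv.sum fun k _ => (dv j k).mul (s i k))).add
    (((HasDirDeriv.sum fun k _ => dv k k).const_mul _).mul (s i j))

theorem hasDirDeriv_covDeriv
    (hΓ : ∀ k i j, DifferentiableAt ℝ (fun z => christoffel G z k i j) y)
    (hS : ∀ i j, ContDiffAt ℝ 2 (fun z => S z i j) y) (a b c k : Fin 3) :
    HasDirDeriv (fun z => covDeriv G S z a b c) (stdVec k)
      (pd (pd (fun z => S z b c) a) k y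
        + ∑ d, (pd (fun z => christoffel G z b a d) k y * S y d c
          + christoffel G y b a d * pd (fun z => S z d c) k y)
        + ∑ d, (pd (fun z => christoffel G z c a d) k y * S y d b
          + christoffel G y c a d * pd (fun z => S z d b) k y)
        - ((2 / (((3 : ℕ) : ℝ) + 1)) * (∑ d, pd (fun z => christoffel G z d d a) k y) * S y b c
          + (2 / (((3 : ℕ) : ℝ) + 1)) * (∑ d, christoffel G y d d a)
            * pd (fun z => S z b c) k y)) y := by
  have g := fun l m n => hasDirDeriv_pd (hΓ l m n) k
  have s := fun l m => hasDirDeriv_pd ((hS l m).differentiableAt (by norm_num)) k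
  have ds := fun l m n => hasDirDeriv_pd (differentiableAt_pd (hS l m) n) k
  exact (((ds b c a).add (HasDirDeriv.sum fun d _ => (g b a d).mul (s d c))).add
    (HasDirDeriv.sum fun d _ => (g c a d).mul (s d b))).sub
    (((HasDirDeriv.sum fun d _ => g d d a).const_mul _).mul (s b c))

/-- The Lie derivative commutes with the covariant derivative up to the Lie derivative of the
connection. -/
theorem covDeriv_lieDeriv (hV : ∀ i, ContDiffAt ℝ 2 (fun z => V z i) y)
    (hΓ : ∀ k i j, DifferentiableAt ℝ (fun z => christoffel G z k i j) y)
    (hS : ∀ i j, ContDiffAt ℝ 2 (fun z => S z i j) y) (hs : ∀ z, (S z).IsSymm)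
    (a b c : Fin 3) :
    covDeriv G (lieDeriv V S) y a b c
      = ∑ k, V y k * pd (fun z => covDeriv G S z a b c) k y
        + ∑ k, pd (fun z => V z k) a y * covDeriv G S y k b c
        - ∑ k, pd (fun z => V z b) k y * covDeriv G S y a k c
        - ∑ k, pd (fun z => V z c) k y * covDeriv G S y a b k
        + (1 / 2) * (∑ k, pd (fun z => V z k) k y) * covDeriv G S y a b c
        - (∑ d, lieConn V G y b a d * S y d c + ∑ d, lieConn V G y c a d * S y d b
          - (1 / 2) * (∑ d, lieConn V G y d d a) * S y b c) := by
  have e1 := (hasDirDeriv_lieDeriv hV hS b c a).pd_eq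
  have e2 := fun k => (hasDirDeriv_covDeriv hΓ hS a b c k).pd_eq
  simp only [e2]
  have s1 : ∀ i j, S y i j = S y j i := fun i j => (hs y).apply j i
  have s2 : ∀ i j, (fun z => S z i j) = fun z => S z j i := fun i j => by
    funext z; exact (hs z).apply j i
  have s3 : ∀ i j k l, pd (pd (fun z => S z i j) k) l y = pd (pd (fun z => S z i j) l) k y :=
    fun i j k l => pd_comm (hS i j) k l
  have s4 : ∀ i k l, pd (pd (fun z => V z i) k) l y = pd (pd (fun z => V z i) l) k y :=
    fun i k l => pd_comm (hV i) k l
  have e3 : ∀ G a b c, covDeriv G (lieDeriv V S) y a b c =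
    pd (fun z => lieDeriv V S z b c) a y
    + ∑ d, christoffel G y b a d * lieDeriv V S y d c
    + ∑ d, christoffel G y c a d * lieDeriv V S y d b
    - (2 / (((3 : ℕ) : ℝ) + 1)) * (∑ d, christoffel G y d d a) * lieDeriv V S y b c :=
    fun _ _ _ _ => rfl
  rw [e3, e1]
  -- Both sides are now polynomials in the partial derivatives of `V` and `S` up to order two and of
  -- the Christoffel symbols up to order one. Symmetry of `S` and of second derivatives brings them
  -- to a common normal form.
  simp only [covDeriv, lieDeriv, lieConn, Matrix.of_apply, Fin.sum_univ_three,
    s3 b c 0 a, s3 b c 1 a, s3 b c 2 a, s4 _ 0 a, s4 _ 1 a, s4 _ 2 a,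
    s1 0 b, s1 1 b, s1 2 b, s1 0 c, s1 1 c, s1 2 c, s1 1 0, s1 2 0, s1 2 1,
    s2 0 b, s2 1 b, s2 2 b, s2 0 c, s2 1 c, s2 2 c]
  push_cast
  ring

/-- If the Lie derivative of the connection is pure trace, the Lie derivative of a solution of the
metrisability system is a solution. -/
theorem linearSystemAt_lieDeriv (hV : ∀ i, ContDiffAt ℝ 2 (fun z => V z i) y)
    (hΓ : ∀ k i j, DifferentiableAt ℝ (fun z => christoffel G z k i j) y)
    (hS : ∀ i j, ContDiffAt ℝ 2 (fun z => S z i j) y) (hs : ∀ z, (S z).IsSymm)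
    (hsol : ∀ᶠ z in nhds y, LinearSystemAt G S z) {ψ : Fin 3 → ℝ}
    (hψ : IsPureTrace (lieConn V G y) ψ) : LinearSystemAt G (lieDeriv V S) y := by
  set μ : E 3 → Fin 3 → ℝ := fun z b => (1 / 4) * ∑ i, covDeriv G S z i i b with hμ
  have hN : ∀ a b c, (fun z => covDeriv G S z a b c) =ᶠ[nhds y] fun z =>
      (if c = a then 1 else 0) * μ z b + (if b = a then 1 else 0) * μ z c := fun a b c =>
    hsol.mono fun z hz => by
      have := hz a b c
      push_cast at this
      simp only [hμ]
      linear_combination this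
  have hμd : ∀ b k, HasDirDeriv (fun z => μ z b) (stdVec k) (pd (fun z => μ z b) k y) y :=
    fun b k => hasDirDeriv_pd ((HasDirDeriv.sum fun i _ =>
      hasDirDeriv_covDeriv hΓ hS i i b k).const_mul (1 / 4 : ℝ)).differentiableAt k
  have hN' : ∀ a b c k, pd (fun z => covDeriv G S z a b c) k y =
      (if c = a then 1 else 0) * pd (fun z => μ z b) k y
        + (if b = a then 1 else 0) * pd (fun z => μ z c) k y := fun a b c k => by
    rw [pd_congr (hN a b c)]
    exact (((hμd b k).const_mul _).add ((hμd c k).const_mul _)).pd_eq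
  have hN0 : ∀ a b c, covDeriv G S y a b c =
      (if c = a then 1 else 0) * μ y b + (if b = a then 1 else 0) * μ y c :=
    fun a b c => (hN a b c).eq_of_nhds
  have s1 : ∀ i j, S y i j = S y j i := fun i j => (hs y).apply j i
  rw [linearSystemAt_iff]
  -- The new `μ` is the Lie derivative of the old one as a weighted vector field, minus the
  -- contraction of `ψ` with `σ`. The terms `ψ_a σ^{bc}` drop out by the same weight count as in
  -- `linearSystemAt_of_parallel`.
  refine ⟨fun b => ∑ k, V y k * pd (fun z => μ z b) k y - ∑ k, pd (fun z => V z b) k y * μ y k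
    + (1 / 2) * (∑ k, pd (fun z => V z k) k y) * μ y b - ∑ d, ψ d * S y d b, fun a b c => ?_⟩
  rw [covDeriv_lieDeriv hV hΓ hS hs]
  simp only [hN', hN0, hψ _ _ _]
  fin_cases a <;> fin_cases b <;> fin_cases c <;>
    simp [Fin.sum_univ_three, s1 1 0, s1 2 0, s1 2 1] <;> ring

end Commutation

/-! ### Charts -/

section Transition

variable {n : ℕ} {M : Type*} [TopologicalSpace M] {e e' : OpenPartialHomeomorph M (E n)}

/-- The transition map between two charts. -/
def transition (e e' : OpenPartialHomeomorph M (E n)) (z : E n) : E n := e' (e.symm z)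

theorem symm_transition {y : E n} (hy' : e.symm y ∈ e'.source) :
    e'.symm (transition e e' y) = e.symm y := e'.left_inv hy'

theorem transition_mem {y : E n} (hy' : e.symm y ∈ e'.source) :
    transition e e' y ∈ e'.target := e'.map_source hy'

theorem eventually_mem_overlap {y : E n} (hy : y ∈ e.target) (hy' : e.symm y ∈ e'.source) :
    ∀ᶠ z in nhds y, z ∈ e.target ∧ e.symm z ∈ e'.source :=
  (e.open_target.eventually_mem hy).and
    ((e.continuousAt_symm hy).eventually (e'.open_source.eventually_mem hy'))

end Transition

section Charts

variable {n : ℕ} {M : Type*} [TopologicalSpace M] [ChartedSpace (E n) M]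

/-- The differential of a chart, as an endomorphism of the model space. -/
def dchart (e : OpenPartialHomeomorph M (E n)) (x : M) : E n →L[ℝ] E n :=
  mfderiv (𝓡 n) (𝓡 n) e x

/-- The differential of the inverse of a chart, as an endomorphism of the model space. -/
def dsymm (e : OpenPartialHomeomorph M (E n)) (y : E n) : E n →L[ℝ] E n :=
  mfderiv (𝓡 n) (𝓡 n) e.symm y

/-- The matrix of `dsymm`. -/
def jacSymm (e : OpenPartialHomeomorph M (E n)) (y : E n) : Matrix (Fin n) (Fin n) ℝ :=
  Matrix.of fun i j => dsymm e y (stdVec j) i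

theorem matrix_comp_apply (A B : E n →L[ℝ] E n) (i j : Fin n) :
    A (B (stdVec j)) i = ∑ k, A (stdVec k) i * B (stdVec j) k := by
  rw [clm_apply_eq_sum A]
  simp [mul_comm, Finset.sum_apply]

variable {e e' : OpenPartialHomeomorph M (E n)}

theorem charts_mdifferentiable (he : e ∈ charts n M) : e.MDifferentiable (𝓡 n) (𝓡 n) :=
  ⟨(contMDiffOn_of_mem_maximalAtlas he).mdifferentiableOn (by simp),
    (contMDiffOn_symm_of_mem_maximalAtlas he).mdifferentiableOn (by simp)⟩

theorem dchart_dsymm (he : e ∈ charts n M) {y : E n} (hy : y ∈ e.target) (u : E n) :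
    dchart e (e.symm y) (dsymm e y u) = u :=
  congrArg (fun L : E n →L[ℝ] E n => L u) ((charts_mdifferentiable he).comp_symm_deriv hy)

theorem dsymm_dchart (he : e ∈ charts n M) {y : E n} (hy : y ∈ e.target) (u : E n) :
    dsymm e y (dchart e (e.symm y) u) = u := by
  have h := congrArg (fun L : E n →L[ℝ] E n => L u)
    ((charts_mdifferentiable he).symm_comp_deriv (e.map_target hy))
  have h' : dsymm e (e (e.symm y)) (dchart e (e.symm y) u) = u := h
  rwa [e.right_inv hy] at h'

theorem jac_mul_jacSymm (he : e ∈ charts n M) {y : E n} (hy : y ∈ e.target) :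
    jac e (e.symm y) * jacSymm e y = 1 := by
  ext i j
  have h := matrix_comp_apply (dchart e (e.symm y)) (dsymm e y) i j
  rw [dchart_dsymm he hy] at h
  rw [Matrix.mul_apply]
  refine h.symm.trans ?_
  simp [stdVec, Matrix.one_apply]

theorem det_jac_ne_zero (he : e ∈ charts n M) {y : E n} (hy : y ∈ e.target) :
    (jac e (e.symm y)).det ≠ 0 := by
  intro h
  have := congrArg Matrix.det (jac_mul_jacSymm he hy)
  rw [Matrix.det_mul, h] at this
  simp at this

theorem contDiffAt_transition (he : e ∈ charts n M) (he' : e' ∈ charts n M) {y : E n}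
    (hy : y ∈ e.target) (hy' : e.symm y ∈ e'.source) : ContDiffAt ℝ ∞ (transition e e') y :=
  ((contMDiffAt_of_mem_maximalAtlas he' hy').comp y
    (contMDiffAt_symm_of_mem_maximalAtlas he hy)).contDiffAt

theorem fderiv_transition (he : e ∈ charts n M) (he' : e' ∈ charts n M) {y : E n}
    (hy : y ∈ e.target) (hy' : e.symm y ∈ e'.source) (u : E n) :
    fderiv ℝ (transition e e') y u = dchart e' (e.symm y) (dsymm e y u) := by
  have h := mfderiv_comp y ((charts_mdifferentiable he').mdifferentiableAt hy')
    ((charts_mdifferentiable he).mdifferentiableAt_symm hy)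
  rw [mfderiv_eq_fderiv] at h
  exact congrArg (fun L : E n →L[ℝ] E n => L u) h

theorem jacMat_transition (he : e ∈ charts n M) (he' : e' ∈ charts n M) {y : E n}
    (hy : y ∈ e.target) (hy' : e.symm y ∈ e'.source) :
    jacMat (transition e e') y = jac e' (e.symm y) * jacSymm e y := by
  ext i j
  rw [Matrix.mul_apply]
  refine Eq.trans ?_ (matrix_comp_apply (dchart e' (e.symm y)) (dsymm e y) i j)
  rw [← fderiv_transition he he' hy hy', ← fderiv_coord]
  · rfl
  · exact (contDiffAt_transition he he' hy hy').differentiableAt (by simp)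

theorem jacSymm_mul_jac (he : e ∈ charts n M) {y : E n} (hy : y ∈ e.target) :
    jacSymm e y * jac e (e.symm y) = 1 :=
  mul_eq_one_comm.mp (jac_mul_jacSymm he hy)

theorem jac_eq_jacMat_mul (he : e ∈ charts n M) (he' : e' ∈ charts n M) {y : E n}
    (hy : y ∈ e.target) (hy' : e.symm y ∈ e'.source) :
    jac e' (e.symm y) = jacMat (transition e e') y * jac e (e.symm y) := by
  rw [jacMat_transition he he' hy hy', Matrix.mul_assoc, jacSymm_mul_jac he hy, Matrix.mul_one]

theorem det_jacMat_transition_ne_zero (he : e ∈ charts n M) (he' : e' ∈ charts n M) {y : E n}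
    (hy : y ∈ e.target) (hy' : e.symm y ∈ e'.source) : (jacMat (transition e e') y).det ≠ 0 := by
  intro h
  have h1 := det_jac_ne_zero he' (transition_mem hy')
  rw [symm_transition hy', jac_eq_jacMat_mul he he' hy hy', Matrix.det_mul, h] at h1
  simp at h1

theorem jacSymm_transition (he : e ∈ charts n M) (he' : e' ∈ charts n M) {y : E n}
    (hy : y ∈ e.target) (hy' : e.symm y ∈ e'.source) :
    jacSymm e y = jacSymm e' (transition e e' y) * jacMat (transition e e') y := by
  have h := jacSymm_mul_jac he' (transition_mem hy')
  rw [symm_transition hy'] at h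
  rw [jacMat_transition he he' hy hy', ← Matrix.mul_assoc, h, Matrix.one_mul]

/-- The fibre basis at `x` is the coordinate basis of the preferred chart. Hence the matrix stored
in a weighted field at `x` is its component matrix in that chart, and fields can be compared through
components. -/
theorem jac_chartAt [IsManifold (𝓡 n) ∞ M] (x : M) : jac (chartAt (E n) x) x = 1 := by
  ext i j
  have h : vecCoords (chartAt (E n) x) x (fibreVec x j) = stdVec j := by
    have h1 := mfderiv_chartAt_eq_tangentCoordChange (I := 𝓡 n) (mem_chart_source (E n) x)
    have h2 := tangentCoordChange_self (I := 𝓡 n) (x := x) (z := x) (v := (stdVec j : E n))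
      (mem_extChartAt_source x)
    rw [vecCoords, h1]
    exact h2
  simp [jac, h, stdVec, Matrix.one_apply]

/-! ### Tensors in charts -/

theorem vecComp_transition (he : e ∈ charts n M) (he' : e' ∈ charts n M) {y : E n}
    (hy : y ∈ e.target) (hy' : e.symm y ∈ e'.source) (v : ∀ x : M, TangentSpace (𝓡 n) x) :
    vecComp v e' (transition e e' y) = fderiv ℝ (transition e e') y (vecComp v e y) := by
  rw [fderiv_transition he he' hy hy']
  have h := dsymm_dchart he hy (v (e.symm y))
  have h1 : vecComp v e y = dchart e (e.symm y) (v (e.symm y)) := rfl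
  rw [h1, h]
  have h2 : ∀ x, x = e.symm y → vecCoords e' x (v x) = dchart e' (e.symm y) (v (e.symm y)) := by
    rintro x rfl; rfl
  exact h2 _ (symm_transition hy')

theorem weighted_comp_transition (he : e ∈ charts n M) (he' : e' ∈ charts n M) {y : E n}
    (hy : y ∈ e.target) (hy' : e.symm y ∈ e'.source) (σ : WeightedField n M) :
    WeightedField.comp σ e' (transition e e' y)
      = |(jacMat (transition e e') y).det| ^ (-(2 / ((n : ℝ) + 1))) •
        (jacMat (transition e e') y * WeightedField.comp σ e y
          * (jacMat (transition e e') y).transpose) := by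
  simp only [WeightedField.comp]
  rw [symm_transition hy', jac_eq_jacMat_mul he he' hy hy', Matrix.det_mul, abs_mul,
    Real.mul_rpow (abs_nonneg _) (abs_nonneg _), Matrix.transpose_mul, mul_smul, Matrix.mul_smul,
    Matrix.smul_mul]
  simp only [Matrix.mul_assoc]

theorem weighted_comp_isSymm (σ : WeightedField n M) (hσ : ∀ x, (σ x).IsSymm)
    (e : OpenPartialHomeomorph M (E n)) (y : E n) : (WeightedField.comp σ e y).IsSymm := by
  unfold Matrix.IsSymm WeightedField.comp
  rw [Matrix.transpose_smul, Matrix.transpose_mul, Matrix.transpose_mul, (hσ _).eq,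
    Matrix.transpose_transpose, Matrix.mul_assoc]

theorem weighted_comp_chartAt [IsManifold (𝓡 n) ∞ M] (σ : WeightedField n M) (x : M) :
    WeightedField.comp σ (chartAt (E n) x) (chartAt (E n) x x) = σ x := by
  simp only [WeightedField.comp, (chartAt (E n) x).left_inv (mem_chart_source (E n) x), jac_chartAt]
  simp

theorem weighted_eq_of_comp [IsManifold (𝓡 n) ∞ M] {σ σ' : WeightedField n M}
    (h : ∀ e ∈ charts n M, ∀ y ∈ e.target, WeightedField.comp σ e y = WeightedField.comp σ' e y) :
    σ = σ' := by
  funext x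
  rw [← weighted_comp_chartAt σ x, ← weighted_comp_chartAt σ' x]
  exact h _ (IsManifold.chart_mem_maximalAtlas x) _ (mem_chart_target (E n) x)

theorem Metric.form_eq_sum (g : Metric n M) (x : M) (u w : E n) :
    g.form x (u : E n) (w : E n) = ∑ i, ∑ j, u i * g.gram x i j * w j := by
  have hu : u = ∑ i, u i • stdVec i := (sum_smul_stdVec u).symm
  have hw : w = ∑ i, w i • stdVec i := (sum_smul_stdVec w).symm
  let B : LinearMap.BilinForm ℝ (E n) := g.form x
  have : B u w = ∑ i, ∑ j, u i * B (stdVec i) (stdVec j) * w j := by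
    conv_lhs => rw [hu, hw]
    simp only [map_sum, LinearMap.sum_apply, map_smul, LinearMap.smul_apply, smul_eq_mul]
    rw [Finset.sum_comm]
    refine Finset.sum_congr rfl fun i _ => ?_
    rw [Finset.mul_sum]
    exact Finset.sum_congr rfl fun j _ => by ring
  exact this

theorem Metric.comp_eq (g : Metric n M) (e : OpenPartialHomeomorph M (E n)) (y : E n) :
    g.comp e y = (jacSymm e y).transpose * g.gram (e.symm y) * jacSymm e y := by
  ext i j
  have h := g.form_eq_sum (e.symm y) (dsymm e y (stdVec i)) (dsymm e y (stdVec j))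
  refine Eq.trans h ?_
  simp only [Matrix.mul_apply, Matrix.transpose_apply, Finset.sum_mul]
  rw [Finset.sum_comm]
  rfl

theorem Metric.gram_isSymm (g : Metric n M) (x : M) : (g.gram x).IsSymm := by
  ext i j
  exact g.symm x _ _

theorem Metric.comp_isSymm (g : Metric n M) (e : OpenPartialHomeomorph M (E n)) (y : E n) :
    (g.comp e y).IsSymm := by
  ext i j
  exact g.symm _ _ _

theorem Metric.det_gram_ne_zero (g : Metric n M) (x : M) : (g.gram x).det ≠ 0 := by
  intro h
  obtain ⟨u, hu, hu0⟩ := Matrix.exists_mulVec_eq_zero_iff.mpr h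
  apply hu
  have h1 : (WithLp.toLp 2 u : E n) = 0 := by
    refine g.nondegenerate x (WithLp.toLp 2 u : E n) fun w => ?_
    refine (g.symm x _ _).trans ((g.form_eq_sum x w (WithLp.toLp 2 u)).trans ?_)
    refine Finset.sum_eq_zero fun i _ => ?_
    have h2 : ∑ j, g.gram x i j * u j = 0 := congrFun hu0 i
    simp only [mul_assoc, ← Finset.mul_sum, h2, mul_zero]
  exact congrArg (WithLp.ofLp) h1

theorem Metric.gram_eq (g : Metric n M) (he : e ∈ charts n M) {y : E n} (hy : y ∈ e.target) :
    g.gram (e.symm y) = (jac e (e.symm y)).transpose * g.comp e y * jac e (e.symm y) := by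
  have h := jacSymm_mul_jac he hy
  have h' := congrArg Matrix.transpose h
  rw [Matrix.transpose_mul, Matrix.transpose_one] at h'
  rw [g.comp_eq, Matrix.mul_assoc, Matrix.mul_assoc _ (jacSymm e y), h, Matrix.mul_one,
    ← Matrix.mul_assoc, h', Matrix.one_mul]

theorem Metric.det_comp_ne_zero (g : Metric n M) (he : e ∈ charts n M) {y : E n}
    (hy : y ∈ e.target) : (g.comp e y).det ≠ 0 := by
  intro h
  have h1 := g.det_gram_ne_zero (e.symm y)
  rw [g.gram_eq he hy, Matrix.det_mul, Matrix.det_mul, h] at h1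
  simp at h1

theorem Metric.comp_transition (g : Metric n M) (he : e ∈ charts n M) (he' : e' ∈ charts n M)
    {y : E n} (hy : y ∈ e.target) (hy' : e.symm y ∈ e'.source) :
    g.comp e y = (jacMat (transition e e') y).transpose * g.comp e' (transition e e' y)
      * jacMat (transition e e') y := by
  rw [g.comp_eq, g.comp_eq, symm_transition hy', jacSymm_transition he he' hy hy',
    Matrix.transpose_mul]
  simp only [Matrix.mul_assoc]

theorem Metric.sigma_comp (g : Metric n M) (he : e ∈ charts n M) {y : E n} (hy : y ∈ e.target) :
    WeightedField.comp g.sigma e y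
      = |(g.comp e y).det| ^ (1 / ((n : ℝ) + 1)) • (g.comp e y)⁻¹ := by
  have hJ := det_jac_ne_zero he hy
  have hu : IsUnit (jac e (e.symm y)).det := isUnit_iff_ne_zero.mpr hJ
  have hut : IsUnit (jac e (e.symm y)).transpose.det := by rwa [Matrix.det_transpose]
  simp only [WeightedField.comp, Metric.sigma]
  rw [g.gram_eq he hy]
  set J := jac e (e.symm y)
  have h1 : J * (J.transpose * g.comp e y * J)⁻¹ * J.transpose = (g.comp e y)⁻¹ := by
    rw [Matrix.mul_inv_rev, Matrix.mul_inv_rev, ← Matrix.mul_assoc, Matrix.mul_nonsing_inv _ hu,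
      Matrix.one_mul, Matrix.mul_assoc, Matrix.nonsing_inv_mul _ hut, Matrix.mul_one]
  rw [Matrix.mul_smul, Matrix.smul_mul, h1, smul_smul]
  congr 1
  rw [Matrix.det_mul, Matrix.det_mul, Matrix.det_transpose, abs_mul, abs_mul]
  have hp : 0 < |J.det| := abs_pos.mpr hJ
  rw [Real.mul_rpow (by positivity) hp.le, Real.mul_rpow hp.le (abs_nonneg _)]
  -- The weight `-2/(n+1)` of the field compensates the two factors `det J` in `det (Jᵀ G J)`, each
  -- raised to the power `1/(n+1)`.
  have h2 : |J.det| ^ (-(2 / ((n : ℝ) + 1))) * |J.det| ^ (1 / ((n : ℝ) + 1))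
      * |J.det| ^ (1 / ((n : ℝ) + 1)) = 1 := by
    rw [← Real.rpow_add hp, ← Real.rpow_add hp]
    convert Real.rpow_zero _ using 2
    ring
  linear_combination |(g.comp e y).det| ^ (1 / ((n : ℝ) + 1)) * h2

theorem Metric.sigma_isSymm (g : Metric n M) (x : M) : (g.sigma x).IsSymm := by
  unfold Matrix.IsSymm Metric.sigma
  rw [Matrix.transpose_smul, Matrix.transpose_nonsing_inv, (g.gram_isSymm x).eq]

end Charts

/-! ### Smoothness of the Christoffel symbols and of `σ_g` in charts -/

section Smoothness

variable {F : Type*} [NormedAddCommGroup F] [NormedSpace ℝ F]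

theorem contDiffOn_det {T : F → Matrix (Fin 3) (Fin 3) ℝ} {Ω : Set F}
    (hT : ∀ i j, ContDiffOn ℝ ∞ (fun z => T z i j) Ω) : ContDiffOn ℝ ∞ (fun z => (T z).det) Ω := by
  simp only [Matrix.det_fin_three]
  fun_prop (disch := exact hT _ _)

theorem contDiffOn_inv_apply {T : F → Matrix (Fin 3) (Fin 3) ℝ} {Ω : Set F}
    (hT : ∀ i j, ContDiffOn ℝ ∞ (fun z => T z i j) Ω) (h0 : ∀ z ∈ Ω, (T z).det ≠ 0) (i j : Fin 3) :
    ContDiffOn ℝ ∞ (fun z => (T z)⁻¹ i j) Ω := by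
  have hd := (contDiffOn_det hT).inv h0
  simp only [Matrix.inv_def, Ring.inverse_eq_inv', Matrix.adjugate_fin_three]
  refine hd.mul ?_
  fin_cases i <;> fin_cases j <;>
    simp only [Fin.zero_eta, Fin.mk_one, Fin.reduceFinMk, Matrix.of_apply, Matrix.cons_val',
      Matrix.cons_val] <;> fun_prop (disch := exact hT _ _)

theorem contDiffOn_christoffel {G : E 3 → Matrix (Fin 3) (Fin 3) ℝ} {Ω : Set (E 3)}
    (hΩ : IsOpen Ω) (hG : ∀ i j, ContDiffOn ℝ ∞ (fun z => G z i j) Ω)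
    (h0 : ∀ z ∈ Ω, (G z).det ≠ 0) (k i j : Fin 3) :
    ContDiffOn ℝ ∞ (fun z => christoffel G z k i j) Ω :=
  contDiffOn_const.mul (ContDiffOn.sum fun h _ => (contDiffOn_inv_apply hG h0 k h).mul
    (((contDiffOn_pd hΩ (hG j h) i).add (contDiffOn_pd hΩ (hG i h) j)).sub
      (contDiffOn_pd hΩ (hG i j) h)))

variable {M : Type*} [TopologicalSpace M] [ChartedSpace (E 3) M]
  {e : OpenPartialHomeomorph M (E 3)}

theorem Metric.contDiffOn_christoffel (g : Metric 3 M) (he : e ∈ charts 3 M) (k i j : Fin 3) :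
    ContDiffOn ℝ ∞ (fun z => christoffel (g.comp e) z k i j) e.target :=
  ProjGeom.contDiffOn_christoffel e.open_target (g.smooth e he)
    (fun _ hz => g.det_comp_ne_zero he hz) k i j

theorem Metric.contDiffOn_sigma_comp (g : Metric 3 M) (he : e ∈ charts 3 M) (i j : Fin 3) :
    ContDiffOn ℝ ∞ (fun z => WeightedField.comp g.sigma e z i j) e.target := by
  have h0 : ∀ z ∈ e.target, (g.comp e z).det ≠ 0 := fun _ hz => g.det_comp_ne_zero he hz
  have hd : ContDiffOn ℝ ∞ (fun z => (g.comp e z).det) e.target :=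
    contDiffOn_det (g.smooth e he)
  have h1 : ContDiffOn ℝ ∞ (fun z => |(g.comp e z).det| ^ (1 / (((3 : ℕ) : ℝ) + 1))
      * (g.comp e z)⁻¹ i j) e.target := by
    refine ContDiffOn.mul (ContDiffOn.rpow_const_of_ne ?_ fun z hz => abs_ne_zero.mpr (h0 z hz))
      (contDiffOn_inv_apply (g.smooth e he) h0 i j)
    exact fun z hz => ContDiffAt.comp_contDiffWithinAt (g := fun t : ℝ => |t|) z
      (contDiffAt_abs (h0 z hz)) (hd z hz)
  refine h1.congr fun z hz => ?_
  rw [g.sigma_comp he hz]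
  rfl

theorem Metric.covDeriv_sigma_comp (g : Metric 3 M) (he : e ∈ charts 3 M) {y : E 3}
    (hy : y ∈ e.target) (a b c : Fin 3) :
    covDeriv (g.comp e) (WeightedField.comp g.sigma e) y a b c = 0 := by
  rw [covDeriv_congr (S' := fun z => |(g.comp e z).det| ^ (1 / ((3 : ℕ) + 1) : ℝ) • (g.comp e z)⁻¹)]
  · exact covDeriv_sigma (fun i j => ((g.smooth e he i j).contDiffAt
      (e.open_target.mem_nhds hy)).differentiableAt (by simp)) (g.comp_isSymm e)
      (g.det_comp_ne_zero he hy) a b c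
  · filter_upwards [e.open_target.mem_nhds hy] with z hz
    exact g.sigma_comp he hz

end Smoothness

/-! ### Geodesics -/

/-- Curves are the case of direction `1` in `ℝ`, so the product and determinant rules for
directional derivatives apply along them. -/
theorem hasDirDeriv_one_iff {R : Type*} [NormedCommRing R] [NormedAlgebra ℝ R] {f : ℝ → R} {f' : R}
    {t : ℝ} : HasDirDeriv f 1 f' t ↔ HasDerivAt f f' t := by
  constructor
  · rintro ⟨L, hL, rfl⟩
    exact hL.hasDerivAt
  · intro h
    exact ⟨_, h.hasFDerivAt, by simp⟩

theorem hasDerivAt_coord {γ : ℝ → E 3} {p : E 3} {t : ℝ} (h : HasDerivAt γ p t) (k : Fin 3) :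
    HasDerivAt (fun s => γ s k) (p k) t :=
  (EuclideanSpace.proj (𝕜 := ℝ) k).hasFDerivAt.comp_hasDerivAt t h

theorem two_le_infty : (2 : ℕ∞ω) ≤ ∞ :=
  WithTop.coe_le_coe.mpr (le_top : (2 : ℕ∞) ≤ ⊤)

/-- Local existence of solutions of `γ'' = -Γ(γ', γ')`. -/
theorem exists_coord_geodesic {Ω : Set (E 3)} (hΩ : IsOpen Ω)
    {Γ : E 3 → Fin 3 → Fin 3 → Fin 3 → ℝ}
    (hΓ : ∀ k i j, ContDiffOn ℝ ∞ (fun z => Γ z k i j) Ω) {y : E 3} (hy : y ∈ Ω) (u : E 3) :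
    ∃ ε > 0, ∃ γ p q : ℝ → E 3, γ 0 = y ∧ p 0 = u ∧ ContDiffOn ℝ ∞ γ (Ioo (-ε) ε) ∧
      ∀ t ∈ Ioo (-ε) ε, γ t ∈ Ω ∧ HasDerivAt γ (p t) t ∧ HasDerivAt p (q t) t ∧
        ∀ k, q t k = -∑ i, ∑ j, Γ (γ t) k i j * p t i * p t j := by
  -- The equation is rewritten as a first-order system for position and velocity.
  set F : E 3 × E 3 → E 3 × E 3 := fun x =>
    (x.2, WithLp.toLp 2 fun k => -∑ i, ∑ j, Γ x.1 k i j * x.2 i * x.2 j) with hF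
  have hFs : ContDiffOn ℝ ∞ F (Ω ×ˢ univ) := by
    refine contDiffOn_snd.prodMk ?_
    rw [contDiffOn_euclidean]
    intro k
    have hc : ∀ i : Fin 3, ContDiff ℝ ∞ fun x : E 3 × E 3 => x.2 i := fun i =>
      (EuclideanSpace.proj (𝕜 := ℝ) i).contDiff.comp contDiff_snd
    exact (ContDiffOn.sum fun i _ => ContDiffOn.sum fun j _ =>
      (((hΓ k i j).comp contDiffOn_fst fun x hx => hx.1).mul (hc i).contDiffOn).mul
        (hc j).contDiffOn).neg
  have hΩ' : IsOpen (Ω ×ˢ (univ : Set (E 3))) := hΩ.prod isOpen_univ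
  have hmem : (y, u) ∈ Ω ×ˢ (univ : Set (E 3)) := ⟨hy, mem_univ _⟩
  obtain ⟨α, hα0, ε, hε, hα⟩ :=
    ((hFs.contDiffAt (hΩ'.mem_nhds hmem)).of_le (by simp)
      : ContDiffAt ℝ 1 F (y, u)).exists_forall_mem_closedBall_exists_eq_forall_mem_Ioo_hasDerivAt₀ 0
  have hcont : ContinuousAt α 0 := (hα 0 (by simp [hε])).continuousAt
  obtain ⟨δ, hδ, hδ'⟩ := Metric.eventually_nhds_iff.mp
    (hcont.eventually (hΩ'.eventually_mem (by rw [hα0]; exact hmem)))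
  -- The interval is shrunk strictly, so that on the closed interval `[-η, η]` the solution both
  -- exists and stays where `F` is smooth; the gain of regularity is applied there.
  obtain ⟨η, hη, hηε, hηδ⟩ : ∃ η > 0, η < ε ∧ η < δ :=
    ⟨min ε δ / 2, by positivity, by linarith [min_le_left ε δ, lt_min hε hδ],
      by linarith [min_le_right ε δ, lt_min hε hδ]⟩
  have hsub : ∀ t ∈ Icc (-η) η, HasDerivAt α (F (α t)) t ∧ α t ∈ Ω ×ˢ (univ : Set (E 3)) := by
    intro t ht
    refine ⟨hα t ⟨by linarith [ht.1], by linarith [ht.2]⟩, hδ' ?_⟩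
    rw [Real.dist_eq, sub_zero]
    exact (abs_le.mpr ht).trans_lt hηδ
  have hsm : ContDiffOn ℝ ∞ α (Icc (-η) η) :=
    ODE.contDiffOn_enat_Icc_of_hasDerivWithinAt (n := ⊤) (f := fun _ => F)
      (u := Ω ×ˢ (univ : Set (E 3)))
      (hFs.comp contDiffOn_snd fun x hx => hx.2) (fun t ht => (hsub t ht).1.hasDerivWithinAt)
      (fun t ht => (hsub t ht).2)
  refine ⟨η, hη, fun t => (α t).1, fun t => (α t).2, fun t => (F (α t)).2, by simp only [hα0],
    by simp only [hα0],
    contDiff_fst.comp_contDiffOn (hsm.mono Ioo_subset_Icc_self), fun t ht => ?_⟩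
  obtain ⟨h1, h2⟩ := hsub t (Ioo_subset_Icc_self ht)
  exact ⟨h2.1, h1.fst, h1.snd, fun k => rfl⟩

/-- First and second derivatives of the image of a curve. -/
theorem deriv_deriv_comp {Ψ : E 3 → E 3} {γ p : ℝ → E 3} {q : E 3} {t : ℝ}
    (hΨ : ContDiffAt ℝ 2 Ψ (γ t)) (hγ : ∀ᶠ s in nhds t, HasDerivAt γ (p s) s)
    (hp : HasDerivAt p q t) :
    (∀ k, deriv (fun s => Ψ (γ s)) t k = ∑ j, jacMat Ψ (γ t) k j * p t j) ∧
    ∀ k, deriv (deriv fun s => Ψ (γ s)) t k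
      = ∑ i, ∑ j, pd (fun z => jacMat Ψ z k j) i (γ t) * p t i * p t j
        + ∑ j, jacMat Ψ (γ t) k j * q j := by
  have hΨe : ∀ᶠ s in nhds t, DifferentiableAt ℝ Ψ (γ s) :=
    (hγ.self_of_nhds.continuousAt.eventually (hΨ.eventually (by simp))).mono fun s hs =>
      hs.differentiableAt (by norm_num)
  have hd : ∀ᶠ s in nhds t, deriv (fun s => Ψ (γ s)) s = fderiv ℝ Ψ (γ s) (p s) := by
    filter_upwards [hγ, hΨe] with s hs hs'
    exact (hs'.hasFDerivAt.comp_hasDerivAt s hs).deriv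
  have hde : ∀ k, (fun s => deriv (fun s => Ψ (γ s)) s k) =ᶠ[nhds t]
      fun s => ∑ j, jacMat Ψ (γ s) k j * p s j := fun k => by
    filter_upwards [hd, hΨe] with s hs hs'
    rw [hs, fderiv_apply_eq_jacMat hs']
  refine ⟨fun k => (hde k).eq_of_nhds, fun k => ?_⟩
  have hdiff : HasDerivAt (deriv fun s => Ψ (γ s))
      (fderiv ℝ (fderiv ℝ Ψ) (γ t) (p t) (p t) + fderiv ℝ Ψ (γ t) q) t := by
    have h1 : DifferentiableAt ℝ (fderiv ℝ Ψ) (γ t) :=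
      (hΨ.fderiv_right (m := 1) (by norm_num)).differentiableAt (by norm_num)
    exact ((h1.hasFDerivAt.comp_hasDerivAt t hγ.self_of_nhds).clm_apply hp).congr_of_eventuallyEq hd
  have h2 := (hasDerivAt_coord hdiff k).congr_of_eventuallyEq (hde k).symm
  have h3 := hasDirDeriv_one_iff.mp <| HasDirDeriv.sum (s := Finset.univ) fun j _ =>
    (hasDirDeriv_comp (w := (1 : ℝ)) (differentiableAt_jacMat hΨ k j)
      hγ.self_of_nhds.differentiableAt).mul (hasDirDeriv_one_iff.mpr (hasDerivAt_coord hp j))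
  rw [hdiff.deriv, h2.unique h3]
  have h4 : ∀ c, fderiv ℝ (fun s => γ s c) t 1 = p t c := fun c =>
    (hasDirDeriv_one_iff.mpr (hasDerivAt_coord hγ.self_of_nhds c)).fderiv_eq
  simp only [h4, Fin.sum_univ_three]
  ring

section

variable {M : Type*} [TopologicalSpace M] [ChartedSpace (E 3) M] {e : OpenPartialHomeomorph M (E 3)}

theorem Metric.IsGeodesic.mono {g : Metric 3 M} {I J : Set ℝ} {γ : ℝ → M} (h : g.IsGeodesic I γ)
    (hJ : J ⊆ I) : g.IsGeodesic J γ := by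
  obtain ⟨h1, f, h2⟩ := h
  exact ⟨h1.mono hJ, f, fun t ht => h2 t (hJ ht)⟩

/-- Through every point and in every direction there is a geodesic. -/
theorem Metric.exists_geodesic (g : Metric 3 M) (he : e ∈ charts 3 M) {y : E 3}
    (hy : y ∈ e.target) (u : E 3) :
    ∃ ε > 0, ∃ γ p q : ℝ → E 3, γ 0 = y ∧ p 0 = u ∧
      (∀ t ∈ Ioo (-ε) ε, γ t ∈ e.target ∧ HasDerivAt γ (p t) t ∧ HasDerivAt p (q t) t ∧
        ∀ k, q t k = -∑ i, ∑ j, christoffel (g.comp e) (γ t) k i j * p t i * p t j) ∧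
      g.IsGeodesic (Ioo (-ε) ε) fun s => e.symm (γ s) := by
  obtain ⟨ε, hε, γ, p, q, h0, hp0, hγs, hγ⟩ := exists_coord_geodesic e.open_target
    (Γ := fun z => christoffel (g.comp e) z) (fun k i j => g.contDiffOn_christoffel he k i j) hy u
  -- The parametrisation is affine, so `f = 0`. The equation is solved in the chart `e` but must
  -- hold in every chart, which is the transformation law of the Christoffel symbols.
  refine ⟨ε, hε, γ, p, q, h0, hp0, hγ, ?_, 0, ?_⟩
  · exact (contMDiffOn_symm_of_mem_maximalAtlas he).comp hγs.contMDiffOn fun t ht => (hγ t ht).1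
  · intro t ht e' he' hte' m
    obtain ⟨hγt, hdγ, hdp, hq⟩ := hγ t ht
    have hΨ := (contDiffAt_transition he he' hγt hte').of_le two_le_infty
    obtain ⟨d1, d2⟩ := deriv_deriv_comp (p := p) hΨ
      (Filter.mem_of_superset (isOpen_Ioo.mem_nhds ht) fun s hs => (hγ s hs).2.1) hdp
    have hc := christoffel_transform (G := g.comp e) (G' := g.comp e') hΨ (det_jacMat_transition_ne_zero he he' hγt hte')
      (fun i j => ((g.smooth e' he' i j).contDiffAt (e'.open_target.mem_nhds
        (transition_mem hte'))).differentiableAt (by simp)) (g.comp_isSymm e')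
      (g.det_comp_ne_zero he' (transition_mem hte'))
      ((eventually_mem_overlap hγt hte').mono fun z hz => g.comp_transition he he' hz.1 hz.2) m
    have hsum : ∑ i, ∑ j, (∑ k, jacMat (transition e e') (γ t) m k *
        christoffel (g.comp e) (γ t) k i j) * p t i * p t j = _ :=
      Finset.sum_congr rfl fun i _ => Finset.sum_congr rfl fun j _ => by rw [hc i j]
    change deriv (deriv fun s => transition e e' (γ s)) t m
      + ∑ i, ∑ j, christoffel (g.comp e') (transition e e' (γ t)) m i j
        * deriv (fun s => transition e e' (γ s)) t i * deriv (fun s => transition e e' (γ s)) t j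
      = (0 : ℝ) * deriv (fun s => transition e e' (γ s)) t m
    simp only [d1, d2, hq]
    simp only [Fin.sum_univ_three] at hsum ⊢
    linear_combination -hsum

/-- The difference of the Levi-Civita connections of projectively equivalent metrics is pure
trace. -/
theorem ProjectivelyEquivalent.exists_isPureTrace {g g' : Metric 3 M}
    (h : ProjectivelyEquivalent g g') (he : e ∈ charts 3 M) {y : E 3} (hy : y ∈ e.target) :
    ∃ ψ, IsPureTrace
      (fun k i j => christoffel (g'.comp e) y k i j - christoffel (g.comp e) y k i j) ψ := by
  refine ProjGeom.exists_isPureTrace (fun k i j => ?_) fun u k l => ?_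
  · rw [christoffel_symm (g.comp_isSymm e), christoffel_symm (g'.comp_isSymm e)]
  -- Along an affine `g`-geodesic with velocity `u`, the second derivative is `-Γ(u,u)`. Inserted in
  -- the geodesic equation of `g'`, this leaves `(Γ' - Γ)(u,u) = f u`.
  obtain ⟨ε, hε, γ, p, q, h0, hp0, hγ, hgeo⟩ := g.exists_geodesic he hy u
  have h00 : (0 : ℝ) ∈ Ioo (-ε) ε := by simp [hε]
  obtain ⟨-, f, hf⟩ := (h _ _ isOpen_Ioo ordConnected_Ioo).mp hgeo
  obtain ⟨hγt, hdγ, hdp, hq⟩ := hγ 0 h00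
  have hf0 := hf 0 h00 e he (e.map_target hγt)
  have hev : (fun s => e (e.symm (γ s))) =ᶠ[nhds 0] γ := by
    filter_upwards [isOpen_Ioo.mem_nhds h00] with s hs
    exact e.right_inv (hγ s hs).1
  have hd : deriv γ =ᶠ[nhds 0] p := by
    filter_upwards [isOpen_Ioo.mem_nhds h00] with s hs
    exact (hγ s hs).2.1.deriv
  simp only [hev.deriv.deriv_eq, hev.deriv_eq, hd.deriv_eq, hdγ.deriv, hdp.deriv, hq,
    hp0, h0, e.right_inv hy] at hf0
  have key : ∀ m, ∑ i, ∑ j, (christoffel (g'.comp e) y m i j - christoffel (g.comp e) y m i j)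
      * u i * u j = f 0 * u m := fun m => by
    simp only [sub_mul, Finset.sum_sub_distrib]
    linear_combination hf0 m
  rw [key, key]
  ring

end

/-! ### Derivatives of one-parameter families -/

section Family

variable {n : ℕ} {N : Set (ℝ × E n)} {H : ℝ × E n → ℝ} {t : ℝ} {y : E n}

theorem contDiffOn_fderiv_apply (hN : IsOpen N) (hH : ContDiffOn ℝ ∞ H N) (w : ℝ × E n) :
    ContDiffOn ℝ ∞ (fun p => fderiv ℝ H p w) N :=
  (hH.fderiv_of_isOpen hN (m := ∞) (by simp)).clm_apply contDiffOn_const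

theorem pd_slice (hH : DifferentiableAt ℝ H (t, y)) (j : Fin n) :
    pd (fun z => H (t, z)) j y = fderiv ℝ H (t, y) (0, stdVec j) := by
  have h1 : HasFDerivAt (fun z : E n => (t, z)) (ContinuousLinearMap.inr ℝ ℝ (E n)) y :=
    hasFDerivAt_prodMk_right t y
  have h2 := hH.hasFDerivAt.comp y h1
  have h3 : fderiv ℝ (fun z => H (t, z)) y = (fderiv ℝ H (t, y)).comp
    (ContinuousLinearMap.inr ℝ ℝ (E n)) := h2.fderiv
  rw [pd, h3]
  simp

theorem hasDerivAt_slice (hH : DifferentiableAt ℝ H (t, y)) :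
    HasDerivAt (fun s => H (s, y)) (fderiv ℝ H (t, y) (1, 0)) t := by
  have h1 : HasDerivAt (fun s : ℝ => (s, y)) ((1 : ℝ), (0 : E n)) t :=
    (hasDerivAt_id t).prodMk (hasDerivAt_const t y)
  exact hH.hasFDerivAt.comp_hasDerivAt t h1

theorem eventually_slice_left (hN : IsOpen N) (h : (t, y) ∈ N) : ∀ᶠ s in nhds t, (s, y) ∈ N :=
  (Continuous.prodMk continuous_id continuous_const).continuousAt.eventually (hN.eventually_mem h)

theorem eventually_slice_right (hN : IsOpen N) (h : (t, y) ∈ N) : ∀ᶠ z in nhds y, (t, z) ∈ N :=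
  (Continuous.prodMk continuous_const continuous_id).continuousAt.eventually (hN.eventually_mem h)

/-- Exchanging time and space derivatives is what turns the time derivative of the Jacobian and
Hessian of a flow into the Jacobian and Hessian of its vector field. -/
theorem fderiv_pd_slice (hN : IsOpen N) (hH : ContDiffOn ℝ ∞ H N) (h : (t, y) ∈ N) (j : Fin n) :
    fderiv ℝ (fun p => fderiv ℝ H p (0, stdVec j)) (t, y) (1, 0)
      = pd (fun z => fderiv ℝ H (t, z) (1, 0)) j y := by
  rw [pd_slice (H := fun p => fderiv ℝ H p (1, 0))
    (((contDiffOn_fderiv_apply hN hH _).contDiffAt (hN.mem_nhds h)).differentiableAt (by simp))]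
  exact fderiv_fderiv_comm ((hH.contDiffAt (hN.mem_nhds h)).of_le two_le_infty) _ _

theorem hasDerivAt_pd_slice (hN : IsOpen N) (hH : ContDiffOn ℝ ∞ H N) (h : (t, y) ∈ N)
    (j : Fin n) :
    HasDerivAt (fun s => pd (fun z => H (s, z)) j y)
      (pd (fun z => fderiv ℝ H (t, z) (1, 0)) j y) t := by
  rw [← fderiv_pd_slice hN hH h]
  refine (hasDerivAt_slice (H := fun p => fderiv ℝ H p (0, stdVec j))
    (((contDiffOn_fderiv_apply hN hH _).contDiffAt (hN.mem_nhds h)).differentiableAt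
      (by simp))).congr_of_eventuallyEq ?_
  filter_upwards [eventually_slice_left hN h] with s hs
  exact pd_slice ((hH.contDiffAt (hN.mem_nhds hs)).differentiableAt (by simp)) j

theorem hasDerivAt_pd_pd_slice (hN : IsOpen N) (hH : ContDiffOn ℝ ∞ H N) (h : (t, y) ∈ N)
    (i j : Fin n) :
    HasDerivAt (fun s => pd (pd (fun z => H (s, z)) j) i y)
      (pd (pd (fun z => fderiv ℝ H (t, z) (1, 0)) j) i y) t := by
  have hslice : ∀ s, (s, y) ∈ N → pd (fun z => H (s, z)) j =ᶠ[nhds y]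
      fun z => fderiv ℝ H (s, z) (0, stdVec j) := fun s hs => by
    filter_upwards [eventually_slice_right hN hs] with z hz
    exact pd_slice ((hH.contDiffAt (hN.mem_nhds hz)).differentiableAt (by simp)) j
  have h1 := hasDerivAt_pd_slice hN (contDiffOn_fderiv_apply hN hH (0, stdVec j)) h i
  have h2 : (fun z => fderiv ℝ (fun p => fderiv ℝ H p (0, stdVec j)) (t, z) (1, 0)) =ᶠ[nhds y]
      pd (fun z => fderiv ℝ H (t, z) (1, 0)) j := by
    filter_upwards [eventually_slice_right hN h] with z hz
    exact fderiv_pd_slice hN hH hz j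
  rw [pd_congr h2] at h1
  refine h1.congr_of_eventuallyEq ?_
  filter_upwards [eventually_slice_left hN h] with s hs
  exact pd_congr (hslice s hs) i

end Family

/-! ### Projective vector fields -/

section Flow

variable {M : Type*} [TopologicalSpace M] [ChartedSpace (E 3) M] {e : OpenPartialHomeomorph M (E 3)}
  {v : ∀ x : M, TangentSpace (𝓡 3) x} {ε : ℝ} {U : Set M} {φ : ℝ → M → M}

theorem IsLocalFlow.hasDerivAt (hφ : IsLocalFlow v ε U φ) (he : e ∈ charts 3 M) {x : M}
    (hx : x ∈ U) {t : ℝ} (ht : t ∈ Ioo (-ε) ε) (hs : φ t x ∈ e.source) :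
    HasDerivAt (fun s => e (φ s x)) (vecComp v e (e (φ t x))) t := by
  have h1 := (hφ.integralCurve x hx t ht).hasMFDerivAt (isOpen_Ioo.mem_nhds ht)
  have h2 := ((charts_mdifferentiable he).mdifferentiableAt hs).hasMFDerivAt.comp t h1
  have h3 : HasFDerivAt (fun s => e (φ s x))
      ((dchart e (φ t x)).comp ((1 : ℝ →L[ℝ] ℝ).smulRight (v (φ t x) : E 3))) t := h2.hasFDerivAt
  -- `v z` lives in a tangent space depending on `z`, so the base point is generalised before
  -- substituting `e.symm (e (φ t x)) = φ t x`.
  have h4 : ∀ z, z = φ t x → vecCoords e z (v z) = vecCoords e (φ t x) (v (φ t x)) := by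
    rintro z rfl; rfl
  have h5 : vecComp v e (e (φ t x)) = vecCoords e (φ t x) (v (φ t x)) := h4 _ (e.left_inv hs)
  rw [h5]
  have h6 : ∀ (L : E 3 →L[ℝ] E 3) (w : E 3), L.comp ((1 : ℝ →L[ℝ] ℝ).smulRight w) 1 = L w := by
    intro L w
    simp
  exact h3.hasDerivAt.congr_deriv (h6 (dchart e (φ t x)) (v (φ t x)))

/-- The local flow read in a chart. -/
def flowMap (e : OpenPartialHomeomorph M (E 3)) (φ : ℝ → M → M) (p : ℝ × E 3) : E 3 :=
  e (φ p.1 (e.symm p.2))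

/-- The domain of `flowMap`. -/
def flowDomain (e : OpenPartialHomeomorph M (E 3)) (ε : ℝ) (U : Set M) (φ : ℝ → M → M) :
    Set (ℝ × E 3) :=
  (Ioo (-ε) ε ×ˢ (e.target ∩ e.symm ⁻¹' U)) ∩ (fun p => φ p.1 (e.symm p.2)) ⁻¹' e.source

theorem IsLocalFlow.contMDiffOn_chart (hφ : IsLocalFlow v ε U φ) (he : e ∈ charts 3 M) :
    ContMDiffOn 𝓘(ℝ, ℝ × E 3) (𝓡 3) ∞ (fun p : ℝ × E 3 => φ p.1 (e.symm p.2))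
      (Ioo (-ε) ε ×ˢ (e.target ∩ e.symm ⁻¹' U)) := by
  have h1 : ContMDiffOn 𝓘(ℝ, ℝ × E 3) 𝓘(ℝ, ℝ) ∞ (fun p : ℝ × E 3 => p.1)
      (Ioo (-ε) ε ×ˢ (e.target ∩ e.symm ⁻¹' U)) := contDiffOn_fst.contMDiffOn
  have h2 : ContMDiffOn 𝓘(ℝ, ℝ × E 3) (𝓡 3) ∞ (fun p : ℝ × E 3 => e.symm p.2)
      (Ioo (-ε) ε ×ˢ (e.target ∩ e.symm ⁻¹' U)) :=
    (contMDiffOn_symm_of_mem_maximalAtlas he).comp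
      (show ContMDiffOn 𝓘(ℝ, ℝ × E 3) 𝓘(ℝ, E 3) ∞ (fun p : ℝ × E 3 => p.2) _ from
        contDiffOn_snd.contMDiffOn) fun p hp => hp.2.1
  exact hφ.smooth.comp (h1.prodMk h2) fun p hp => ⟨hp.1, hp.2.2⟩

theorem IsLocalFlow.isOpen_flowDomain (hφ : IsLocalFlow v ε U φ) (hU : IsOpen U)
    (he : e ∈ charts 3 M) : IsOpen (flowDomain e ε U φ) :=
  (hφ.contMDiffOn_chart he).continuousOn.isOpen_inter_preimage
    (isOpen_Ioo.prod (e.isOpen_inter_preimage_symm hU)) e.open_source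

theorem IsLocalFlow.contDiffOn_flowMap (hφ : IsLocalFlow v ε U φ) (he : e ∈ charts 3 M) :
    ContDiffOn ℝ ∞ (flowMap e φ) (flowDomain e ε U φ) := by
  have h := (contMDiffOn_of_mem_maximalAtlas he).comp
    ((hφ.contMDiffOn_chart he).mono inter_subset_left) fun p hp => hp.2
  exact h.contDiffOn

theorem IsLocalFlow.zero_mem_flowDomain (hφ : IsLocalFlow v ε U φ) (hε : 0 < ε) {z : E 3}
    (hz : z ∈ e.target) (hzU : e.symm z ∈ U) : ((0 : ℝ), z) ∈ flowDomain e ε U φ := by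
  refine ⟨⟨by simp [hε], hz, hzU⟩, ?_⟩
  simp only [mem_preimage, hφ.initial _ hzU]
  exact e.map_target hz

theorem IsLocalFlow.flowMap_zero (hφ : IsLocalFlow v ε U φ) {z : E 3}
    (hz : z ∈ e.target) (hzU : e.symm z ∈ U) : flowMap e φ (0, z) = z := by
  simp only [flowMap, hφ.initial _ hzU, e.right_inv hz]

/-- The flow of a projective vector field maps geodesics to geodesics, in a chart. -/
theorem flow_parallel {g : Metric 3 M} (hφ : IsLocalFlow v ε U φ) (hU : IsOpen U)
    (he : e ∈ charts 3 M)
    (hproj : ∀ t ∈ Ioo (-ε) ε, ∀ (I : Set ℝ) (γ : ℝ → M), IsOpen I → I.OrdConnected →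
      MapsTo γ I U → g.IsGeodesic I γ → g.IsGeodesic I (fun s => φ t (γ s)))
    {t : ℝ} {y : E 3} (hty : (t, y) ∈ flowDomain e ε U φ) (u : E 3) :
    ∃ f : ℝ, ∀ k, ∑ i, ∑ j, pd (pd (fun z => flowMap e φ (t, z) k) j) i y * u i * u j
      - ∑ m, pd (fun z => flowMap e φ (t, z) k) m y *
          ∑ i, ∑ j, christoffel (g.comp e) y m i j * u i * u j
      + ∑ i, ∑ j, christoffel (g.comp e) (flowMap e φ (t, y)) k i j
          * (∑ m, pd (fun z => flowMap e φ (t, z) i) m y * u m)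
          * (∑ m, pd (fun z => flowMap e φ (t, z) j) m y * u m)
      = f * ∑ m, pd (fun z => flowMap e φ (t, z) k) m y * u m := by
  obtain ⟨δ, hδ, γ, p, q, h0, hp0, hγ, hgeo⟩ := g.exists_geodesic he hty.1.2.1 u
  have h00 : (0 : ℝ) ∈ Ioo (-δ) δ := by simp [hδ]
  obtain ⟨hγt, hdγ, hdp, hq⟩ := hγ 0 h00
  -- The geodesic is shortened to stay in `U`, as the assumption on the flow concerns only geodesics
  -- there.
  obtain ⟨η, hη, hη'⟩ : ∃ η > 0, η ≤ δ ∧ ∀ s ∈ Ioo (-η) η, e.symm (γ s) ∈ U := by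
    have hc : ContinuousAt (fun s => e.symm (γ s)) 0 :=
      ContinuousAt.comp (e.continuousAt_symm hγt) hdγ.continuousAt
    obtain ⟨r, hr, hr'⟩ := Metric.eventually_nhds_iff.mp
      (hc.eventually (hU.eventually_mem (by simp only [h0]; exact hty.1.2.2)))
    refine ⟨min δ r, lt_min hδ hr, min_le_left _ _, fun s hs => hr' ?_⟩
    rw [Real.dist_eq, sub_zero]
    exact (abs_lt.mpr hs).trans_le (min_le_right _ _)
  have hsub : Ioo (-η) η ⊆ Ioo (-δ) δ := Ioo_subset_Ioo (by linarith [hη'.1]) hη'.1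
  obtain ⟨-, f, hf⟩ := hproj t hty.1.1 (Ioo (-η) η) (fun s => e.symm (γ s)) isOpen_Ioo
    ordConnected_Ioo hη'.2 (hgeo.mono hsub)
  refine ⟨f 0, fun k => ?_⟩
  have hf0 := hf 0 (by simp [hη]) e he (by simp only [h0]; exact hty.2) k
  have hsm : ContDiffAt ℝ 2 (fun z => flowMap e φ (t, z)) (γ 0) := by
    rw [h0]
    exact (((hφ.contDiffOn_flowMap he).contDiffAt
      ((hφ.isOpen_flowDomain hU he).mem_nhds hty)).of_le two_le_infty).comp y
        (contDiffAt_const.prodMk contDiffAt_id)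
  obtain ⟨d1, d2⟩ := deriv_deriv_comp hsm (p := p)
    (Filter.mem_of_superset (isOpen_Ioo.mem_nhds h00) fun s hs => (hγ s hs).2.1) hdp
  change deriv (deriv fun s => flowMap e φ (t, γ s)) 0 k
      + ∑ i, ∑ j, christoffel (g.comp e) (flowMap e φ (t, γ 0)) k i j
        * deriv (fun s => flowMap e φ (t, γ s)) 0 i * deriv (fun s => flowMap e φ (t, γ s)) 0 j
      = f 0 * deriv (fun s => flowMap e φ (t, γ s)) 0 k at hf0
  simp only [d1, d2, hq, h0, hp0] at hf0
  rw [← (show _ = f 0 * ∑ m, pd (fun z => flowMap e φ (t, z) k) m y * u m from hf0)]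
  simp only [mul_neg, Finset.sum_neg_distrib, ← sub_eq_add_neg]
  rfl

/-- The Lie derivative of the Levi-Civita connection along a projective vector field is pure
trace. -/
theorem Metric.IsProjectiveVectorField.exists_isPureTrace {g : Metric 3 M}
    (hv : g.IsProjectiveVectorField v) (he : e ∈ charts 3 M) {y : E 3} (hy : y ∈ e.target) :
    ∃ ψ, IsPureTrace (lieConn (vecComp v e) (g.comp e) y) ψ := by
  obtain ⟨hvs, hv⟩ := hv
  obtain ⟨U, ε, φ, hU, hyU, hε, hφ, hproj⟩ := hv (e.symm y)
  set Φ := flowMap e φ with hΦ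
  set N := flowDomain e ε U φ with hNdef
  have hN : IsOpen N := hφ.isOpen_flowDomain hU he
  have h0N : ((0 : ℝ), y) ∈ N := hφ.zero_mem_flowDomain hε hy hyU
  have hΦs : ∀ k, ContDiffOn ℝ ∞ (fun p => Φ p k) N := fun k p hp =>
    ((EuclideanSpace.proj (𝕜 := ℝ) k).contDiff.contDiffAt).comp_contDiffWithinAt p
      (hφ.contDiffOn_flowMap he p hp)
  have hnear : ∀ᶠ z in nhds y, z ∈ e.target ∧ e.symm z ∈ U :=
    (e.open_target.eventually_mem hy).and
      ((e.continuousAt_symm hy).eventually (hU.eventually_mem hyU))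
  have hΦ0 : ∀ k, (fun z => Φ (0, z) k) =ᶠ[nhds y] fun z => z k := fun k => by
    filter_upwards [hnear] with z hz
    rw [hΦ, hφ.flowMap_zero hz.1 hz.2]
  have hV : ∀ k, (fun z => fderiv ℝ (fun p => Φ p k) (0, z) (1, 0)) =ᶠ[nhds y]
      fun z => vecComp v e z k := fun k => by
    filter_upwards [hnear] with z hz
    have hzN : ((0 : ℝ), z) ∈ N := hφ.zero_mem_flowDomain hε hz.1 hz.2
    have h1 := hasDerivAt_slice (H := fun p => Φ p k)
      (((hΦs k).contDiffAt (hN.mem_nhds hzN)).differentiableAt (by simp))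
    have h2 := hasDerivAt_coord (hφ.hasDerivAt he hz.2 (t := 0) (by simp [hε]) hzN.2) k
    rw [hφ.initial _ hz.2, e.right_inv hz.1] at h2
    exact h1.unique h2
  have hpd0 : ∀ k j, pd (fun z => Φ (0, z) k) j =ᶠ[nhds y]
      fun _ => if k = j then 1 else 0 := fun k j => by
    filter_upwards [(hΦ0 k).eventuallyEq_nhds] with z hz
    rw [pd_congr hz, pd, fderiv_coord (by fun_prop)]
    simp [stdVec]
  -- the ingredients at time zero and their derivatives
  have a' : ∀ k j, HasDerivAt (fun t => pd (fun z => Φ (t, z) k) j y)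
      (pd (fun z => vecComp v e z k) j y) 0 := fun k j => by
    rw [← pd_congr (hV k)]
    exact hasDerivAt_pd_slice hN (hΦs k) h0N j
  have b' : ∀ k i j, HasDerivAt (fun t => pd (pd (fun z => Φ (t, z) k) j) i y)
      (pd (pd (fun z => vecComp v e z k) j) i y) 0 := fun k i j => by
    have h1 : pd (fun z => fderiv ℝ (fun p => Φ p k) (0, z) (1, 0)) j =ᶠ[nhds y]
        pd (fun z => vecComp v e z k) j := by
      filter_upwards [(hV k).eventuallyEq_nhds] with z hz
      exact pd_congr hz j
    rw [← pd_congr h1]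
    exact hasDerivAt_pd_pd_slice hN (hΦs k) h0N i j
  have a0 : ∀ k j, pd (fun z => Φ (0, z) k) j y = if k = j then 1 else 0 :=
    fun k j => (hpd0 k j).eq_of_nhds
  have b0 : ∀ k i j, pd (pd (fun z => Φ (0, z) k) j) i y = 0 := fun k i j => by
    rw [pd_congr (hpd0 k j)]
    simp [pd]
  have hΦy : Φ (0, y) = y := hφ.flowMap_zero hy hyU
  have hΦt : HasDerivAt (fun t => Φ (t, y)) (vecComp v e y) 0 := by
    have h2 := hφ.hasDerivAt he hyU (t := 0) (by simp [hε]) h0N.2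
    rwa [hφ.initial _ hyU, e.right_inv hy] at h2
  have c' : ∀ k i j, HasDerivAt (fun t => christoffel (g.comp e) (Φ (t, y)) k i j)
      (∑ m, vecComp v e y m * pd (fun z => christoffel (g.comp e) z k i j) m y) 0 := by
    intro k i j
    have hd : DifferentiableAt ℝ (fun z => christoffel (g.comp e) z k i j) (Φ (0, y)) := by
      rw [hΦy]
      exact ((g.contDiffOn_christoffel he k i j).contDiffAt
        (e.open_target.mem_nhds hy)).differentiableAt (by simp)
    have h1 := hasDirDeriv_one_iff.mp
      (hasDirDeriv_comp (w := (1 : ℝ)) (τ := fun t => Φ (t, y)) hd hΦt.differentiableAt)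
    refine h1.congr_deriv (Finset.sum_congr rfl fun m _ => ?_)
    rw [hΦy, (hasDirDeriv_one_iff.mpr (hasDerivAt_coord hΦt m)).fderiv_eq, mul_comm]
  refine ProjGeom.exists_isPureTrace (fun k i j => ?_) fun u k l => ?_
  · have hcd : ContDiffAt ℝ 2 (fun z => vecComp v e z k) y :=
      contDiffAt_coord (((hvs e he).contDiffAt (e.open_target.mem_nhds hy)).of_le two_le_infty) k
    have hcs : ∀ z k i j, christoffel (g.comp e) z k i j = christoffel (g.comp e) z k j i :=
      fun z => christoffel_symm (g.comp_isSymm e)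
    have e1 : (fun z => christoffel (g.comp e) z k i j) = fun z => christoffel (g.comp e) z k j i :=
      funext fun z => hcs z k i j
    simp only [lieConn, pd_comm hcd i j, e1, Fin.sum_univ_three, hcs y _ i j, hcs y k j 0,
      hcs y k j 1, hcs y k j 2, hcs y k i 0, hcs y k i 1, hcs y k i 2]
    ring
  · set Q : Fin 3 → ℝ := fun m => ∑ i, ∑ j, christoffel (g.comp e) y m i j * u i * u j with hQ
    set W : Fin 3 → ℝ → ℝ := fun k t => ∑ m, pd (fun z => Φ (t, z) k) m y * u m with hW
    set X : Fin 3 → ℝ → ℝ := fun k t =>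
      ∑ i, ∑ j, pd (pd (fun z => Φ (t, z) k) j) i y * u i * u j
      - ∑ m, pd (fun z => Φ (t, z) k) m y * Q m
      + ∑ i, ∑ j, christoffel (g.comp e) (Φ (t, y)) k i j * W i t * W j t with hX
    -- The proportionality factor depends on `t` with no known regularity, so it is eliminated
    -- before differentiating. At `t = 0` one has `X = 0` and `W = u`, so the derivative of this
    -- relation involves only `X'(0) = (ℒ_v Γ)(u,u)`.
    have hpar : ∀ᶠ t in nhds (0 : ℝ), X k t * W l t - X l t * W k t = 0 := by
      filter_upwards [eventually_slice_left hN h0N] with t ht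
      obtain ⟨f, hf⟩ := flow_parallel hφ hU he hproj ht u
      have h1 : X k t = f * W k t := hf k
      have h2 : X l t = f * W l t := hf l
      rw [h1, h2]
      ring
    have hW0 : ∀ k, W k 0 = u k := fun k => by simp [hW, a0]
    have hX0 : ∀ k, X k 0 = 0 := fun k => by
      simp only [hX, hW0, a0, b0, hΦy]
      simp [hQ]
    have hW' : ∀ k, HasDerivAt (W k) (∑ m, pd (fun z => vecComp v e z k) m y * u m) 0 := fun k =>
      HasDerivAt.fun_sum fun m _ => (a' k m).mul_const (u m)
    have hX' : ∀ k, HasDerivAt (X k)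
        (∑ i, ∑ j, lieConn (vecComp v e) (g.comp e) y k i j * u i * u j) 0 := fun k => by
      have h1 := ((HasDerivAt.fun_sum fun i (_ : i ∈ Finset.univ) =>
        HasDerivAt.fun_sum fun j (_ : j ∈ Finset.univ) =>
          ((b' k i j).mul_const (u i)).mul_const (u j)).sub
        (HasDerivAt.fun_sum fun m (_ : m ∈ Finset.univ) => (a' k m).mul_const (Q m))).add
        (HasDerivAt.fun_sum fun i (_ : i ∈ Finset.univ) =>
          HasDerivAt.fun_sum fun j (_ : j ∈ Finset.univ) =>
            ((c' k i j).mul (hW' i)).mul (hW' j))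
      refine HasDerivAt.congr_deriv h1 ?_
      simp only [hW0, hΦy, lieConn, hQ, Fin.sum_univ_three, Pi.mul_apply]
      ring
    have h1 := ((hX' k).mul (hW' l)).sub ((hX' l).mul (hW' k))
    have h2 := (hasDerivAt_const (0 : ℝ) (0 : ℝ)).congr_of_eventuallyEq hpar
    have h3 := h1.unique h2
    simp only [hW0, hX0, zero_mul, add_zero] at h3
    linear_combination h3

end Flow

/-! ### The action of a projective vector field on the metrisation space -/

theorem contDiffOn_lieDeriv {V : E 3 → E 3} {S : E 3 → Matrix (Fin 3) (Fin 3) ℝ} {Ω : Set (E 3)}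
    (hΩ : IsOpen Ω) (hV : ContDiffOn ℝ ∞ V Ω) (hS : ∀ i j, ContDiffOn ℝ ∞ (fun z => S z i j) Ω)
    (i j : Fin 3) : ContDiffOn ℝ ∞ (fun z => lieDeriv V S z i j) Ω := by
  have hv : ∀ k, ContDiffOn ℝ ∞ (fun z => V z k) Ω := fun k p hp =>
    ((EuclideanSpace.proj (𝕜 := ℝ) k).contDiff.contDiffAt).comp_contDiffWithinAt p (hV p hp)
  have hdv := fun k l => contDiffOn_pd hΩ (hv k) l
  have hds := fun k l m => contDiffOn_pd hΩ (hS k l) m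
  exact (((ContDiffOn.sum fun k _ => (hv k).mul (hds i j k)).sub
    (ContDiffOn.sum fun k _ => (hdv i k).mul (hS k j))).sub
    (ContDiffOn.sum fun k _ => (hdv j k).mul (hS i k))).add
    ((contDiffOn_const.mul (ContDiffOn.sum fun k _ => hdv k k)).mul (hS i j))

theorem lieDeriv_isSymm {V : E 3 → E 3} {S : E 3 → Matrix (Fin 3) (Fin 3) ℝ}
    (hs : ∀ z, (S z).IsSymm) (y : E 3) : (lieDeriv V S y).IsSymm := by
  have s : ∀ i j, (fun z => S z i j) = fun z => S z j i := fun i j => by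
    funext z; exact (hs z).apply j i
  have s' : ∀ i j, S y i j = S y j i := fun i j => (hs y).apply j i
  ext i j
  simp only [lieDeriv, Matrix.transpose_apply, Matrix.of_apply, s j i, Fin.sum_univ_three,
    s' 0 i, s' 1 i, s' 2 i, s' j 0, s' j 1, s' j 2, s' j i]
  ring

section

variable {M : Type*} [TopologicalSpace M] [ChartedSpace (E 3) M]

/-- The Lie derivative of a weighted field. -/
def lieField (v : ∀ x : M, TangentSpace (𝓡 3) x) (σ : WeightedField 3 M) : WeightedField 3 M :=
  fun x => lieDeriv (vecComp v (chartAt (E 3) x)) (WeightedField.comp σ (chartAt (E 3) x))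
    (chartAt (E 3) x x)

variable {e : OpenPartialHomeomorph M (E 3)} {v : ∀ x : M, TangentSpace (𝓡 3) x}
  {σ : WeightedField 3 M}

/-- `lieField` is defined point by point in the preferred chart, which varies with the point.
Naturality under the transition map to `e` shows that the definition agrees with the coordinate
formula in every chart. -/
theorem lieField_comp [IsManifold (𝓡 3) ∞ M] (hv : IsSmoothVectorField v)
    (hσ : ∀ e ∈ charts 3 M, ∀ i j, ContDiffOn ℝ ∞ (fun y => WeightedField.comp σ e y i j) e.target)
    (he : e ∈ charts 3 M) {y : E 3} (hy : y ∈ e.target) :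
    WeightedField.comp (lieField v σ) e y = lieDeriv (vecComp v e) (WeightedField.comp σ e) y := by
  set x := e.symm y with hx
  set c := chartAt (E 3) x with hc
  have hcm : c ∈ charts 3 M := IsManifold.chart_mem_maximalAtlas x
  have hxc : x ∈ c.source := mem_chart_source (E 3) x
  have hz : c x ∈ c.target := c.map_source hxc
  have hxe : c.symm (c x) = x := c.left_inv hxc
  have hz' : c.symm (c x) ∈ e.source := by rw [hxe]; exact e.map_target hy
  have hτ : transition c e (c x) = y := by rw [transition, hxe, hx, e.right_inv hy]
  have h1 := weighted_comp_transition hcm he hz hz' (lieField v σ)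
  have hyt : transition c e (c x) ∈ e.target := transition_mem hz'
  have h2 := lieDeriv_transform (τ := transition c e) (y := c x) (V := vecComp v c)
    (V' := vecComp v e) (S := WeightedField.comp σ c) (S' := WeightedField.comp σ e)
    ((contDiffAt_transition hcm he hz hz').of_le two_le_infty)
    (det_jacMat_transition_ne_zero hcm he hz hz')
    (((hv c hcm).contDiffAt (c.open_target.mem_nhds hz)).differentiableAt (by simp))
    (((hv e he).contDiffAt (e.open_target.mem_nhds hyt)).differentiableAt (by simp))
    (fun i j => ((hσ c hcm i j).contDiffAt (c.open_target.mem_nhds hz)).differentiableAt (by simp))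
    (fun i j => ((hσ e he i j).contDiffAt (e.open_target.mem_nhds hyt)).differentiableAt (by simp))
    ((eventually_mem_overlap hz hz').mono fun z h => vecComp_transition hcm he h.1 h.2 v)
    ((eventually_mem_overlap hz hz').mono fun z h => weighted_comp_transition hcm he h.1 h.2 σ)
  rw [weighted_comp_chartAt] at h1
  rw [← hτ, h1, h2]
  rfl

theorem lieField_mem_solSpace [IsManifold (𝓡 3) ∞ M] {g : Metric 3 M}
    (hv : g.IsProjectiveVectorField v) (hσ : σ ∈ g.solSpace) : lieField v σ ∈ g.solSpace := by
  obtain ⟨hs, hσ⟩ := hσ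
  have hcomp : ∀ e ∈ charts 3 M, ∀ y ∈ e.target, WeightedField.comp (lieField v σ) e y
      = lieDeriv (vecComp v e) (WeightedField.comp σ e) y := fun e he y hy =>
    lieField_comp hv.1 (fun e he => (hσ e he).1) he hy
  refine ⟨fun x => lieDeriv_isSymm (weighted_comp_isSymm σ hs _) _, fun e he => ⟨fun i j => ?_,
    fun y hy => ?_⟩⟩
  · refine (contDiffOn_lieDeriv e.open_target (hv.1 e he) (hσ e he).1 i j).congr fun z hz => ?_
    rw [hcomp e he z hz]
  · obtain ⟨ψ, hψ⟩ := hv.exists_isPureTrace he hy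
    have hn := e.open_target.mem_nhds hy
    have h1 : LinearSystemAt (g.comp e) (lieDeriv (vecComp v e) (WeightedField.comp σ e)) y :=
      linearSystemAt_lieDeriv
        (fun i => contDiffAt_coord (((hv.1 e he).contDiffAt hn).of_le two_le_infty) i)
        (fun k i j => ((g.contDiffOn_christoffel he k i j).contDiffAt hn).differentiableAt (by simp))
        (fun i j => (((hσ e he).1 i j).contDiffAt hn).of_le two_le_infty)
        (weighted_comp_isSymm σ hs e)
        (Filter.mem_of_superset hn fun z hz => (hσ e he).2 z hz) hψ
    have hev : WeightedField.comp (lieField v σ) e =ᶠ[nhds y]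
        lieDeriv (vecComp v e) (WeightedField.comp σ e) :=
      Filter.mem_of_superset hn fun z hz => hcomp e he z hz
    intro a b c
    simp only [covDeriv_congr hev]
    exact h1 a b c

theorem ProjectivelyEquivalent.sigma_mem_solSpace {g g' : Metric 3 M}
    (h : ProjectivelyEquivalent g g') : g'.sigma ∈ g.solSpace := by
  refine ⟨g'.sigma_isSymm, fun e he => ⟨fun i j => g'.contDiffOn_sigma_comp he i j,
    fun y hy => ?_⟩⟩
  obtain ⟨ψ, hψ⟩ := h.exists_isPureTrace he hy
  exact linearSystemAt_of_parallel (weighted_comp_isSymm _ g'.sigma_isSymm e y)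
    (g'.covDeriv_sigma_comp he hy) hψ

theorem isActionMatrix_iff [IsManifold (𝓡 3) ∞ M] {g : Metric 3 M} {σ' : WeightedField 3 M}
    (hv : IsSmoothVectorField v) (hσ : σ ∈ g.solSpace) (hσ' : σ' ∈ g.solSpace)
    (A : Matrix (Fin 2) (Fin 2) ℝ) :
    IsActionMatrix v σ σ' A ↔ lieField v σ = A 0 0 • σ + A 0 1 • σ' ∧
      lieField v σ' = A 1 0 • σ + A 1 1 • σ' := by
  have h1 := fun e he y hy => lieField_comp (e := e) (y := y) hv (fun e he => (hσ.2 e he).1) he hy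
  have h2 := fun e he y hy => lieField_comp (e := e) (y := y) hv (fun e he => (hσ'.2 e he).1) he hy
  have h3 : ∀ (a b : ℝ) e y, WeightedField.comp (a • σ + b • σ') e y
      = a • WeightedField.comp σ e y + b • WeightedField.comp σ' e y := fun a b e y => by
    rw [WeightedField.comp_add, WeightedField.comp_smul, WeightedField.comp_smul]
    rfl
  constructor
  · intro h
    constructor
    · refine weighted_eq_of_comp fun e he y hy => ?_
      rw [h1 e he y hy, h3, (h e he y hy).1]
    · refine weighted_eq_of_comp fun e he y hy => ?_
      rw [h2 e he y hy, h3, (h e he y hy).2]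
  · rintro ⟨e1, e2⟩ e he y hy
    rw [← h1 e he y hy, ← h2 e he y hy, e1, e2, h3, h3]
    exact ⟨rfl, rfl⟩

/-! ### Linear independence -/

theorem Metric.form_ext_of_gram {g g' : Metric 3 M} {x : M} {c : ℝ}
    (h : g'.gram x = c • g.gram x) : g'.form x = c • g.form x := by
  refine LinearMap.ext fun u => LinearMap.ext fun w => ?_
  have h1 := g.form_eq_sum x u w
  have h2 := g'.form_eq_sum x u w
  refine h2.trans ?_
  refine Eq.trans ?_ (congrArg (c * ·) h1).symm
  simp only [h, Matrix.smul_apply, smul_eq_mul, Finset.mul_sum]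
  exact Finset.sum_congr rfl fun i _ => Finset.sum_congr rfl fun j _ => by ring

/-- The determinant of `|det G|^{1/4} G⁻¹` is `|det G|^{-1/4}` up to sign, so the weighted inverse
determines `G`. The resulting factor depends on `k` alone, hence is the same at all points of a
manifold when `k` is. -/
theorem abs_det_rpow_smul_inv_inj {G G' : Matrix (Fin 3) (Fin 3) ℝ} (hG : G.det ≠ 0)
    (hG' : G'.det ≠ 0) {k : ℝ}
    (h : |G'.det| ^ (1 / (((3 : ℕ) : ℝ) + 1)) • G'⁻¹
      = k • (|G.det| ^ (1 / (((3 : ℕ) : ℝ) + 1)) • G⁻¹)) :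
    G' = (k * |k| ^ 3)⁻¹ • G := by
  set r := |G.det| ^ (1 / (((3 : ℕ) : ℝ) + 1)) with hr
  set r' := |G'.det| ^ (1 / (((3 : ℕ) : ℝ) + 1)) with hr'
  have hp : 0 < r := Real.rpow_pos_of_pos (abs_pos.mpr hG) _
  have hp' : 0 < r' := Real.rpow_pos_of_pos (abs_pos.mpr hG') _
  have r4 : ∀ x : ℝ, (|x| ^ (1 / (((3 : ℕ) : ℝ) + 1))) ^ 4 = |x| := fun x => by
    rw [← Real.rpow_natCast, ← Real.rpow_mul (abs_nonneg _)]
    norm_num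
  have hdet := congrArg (fun A => |A.det|) h
  simp only [Matrix.det_smul, Fintype.card_fin, abs_mul, abs_pow, abs_of_pos hp, abs_of_pos hp',
    Matrix.det_nonsing_inv, Ring.inverse_eq_inv', abs_inv] at hdet
  rw [← r4 G.det, ← r4 G'.det, ← hr, ← hr'] at hdet
  have hk : r = |k| ^ 3 * r' := by
    field_simp at hdet
    linarith
  have hk0 : k ≠ 0 := by
    rintro rfl
    rw [hk] at hp
    simp at hp
  have h1 : G'⁻¹ = (k * |k| ^ 3) • G⁻¹ := by
    have h2 : r' • G'⁻¹ = r' • ((k * |k| ^ 3) • G⁻¹) := by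
      rw [h, hk, smul_smul, smul_smul]
      congr 1
      ring
    exact smul_right_injective _ hp'.ne' h2
  have h3 := congrArg (fun A => G' * A * G) h1
  simp only [Matrix.mul_smul, Matrix.smul_mul] at h3
  rw [Matrix.mul_nonsing_inv _ (isUnit_iff_ne_zero.mpr hG'), Matrix.mul_assoc,
    Matrix.nonsing_inv_mul _ (isUnit_iff_ne_zero.mpr hG), Matrix.mul_one, Matrix.one_mul] at h3
  rw [h3, smul_smul, inv_mul_cancel₀ (by positivity), one_smul]

theorem Metric.sigma_ne_zero [Nonempty M] (g : Metric 3 M) : g.sigma ≠ 0 := by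
  intro h
  obtain ⟨x⟩ := ‹Nonempty M›
  have h1 := congrArg Matrix.det (congrFun h x)
  simp only [Metric.sigma, Matrix.det_smul, Pi.zero_apply, Matrix.det_nonsing_inv,
    Ring.inverse_eq_inv'] at h1
  have hg := g.det_gram_ne_zero x
  have : 0 < |(g.gram x).det| ^ (1 / (((3 : ℕ) : ℝ) + 1)) :=
    Real.rpow_pos_of_pos (abs_pos.mpr hg) _
  rw [Matrix.det_zero] at h1
  exact absurd h1 (by positivity)

theorem sigma_linearIndependent {g g' : Metric 3 M} (h : ¬ Proportional g g') {s t : ℝ}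
    (hst : s • g.sigma + t • g'.sigma = 0) : s = 0 ∧ t = 0 := by
  have ht : t = 0 := by
    by_contra ht
    refine h ⟨((-s / t) * |-s / t| ^ 3)⁻¹, fun x => Metric.form_ext_of_gram ?_⟩
    refine abs_det_rpow_smul_inv_inj (g.det_gram_ne_zero x) (g'.det_gram_ne_zero x) ?_
    have h1 : s • g.sigma x + t • g'.sigma x = 0 := congrFun hst x
    have h2 : g'.sigma x = (-s / t) • g.sigma x := by
      have h3 : t • g'.sigma x = t • ((-s / t) • g.sigma x) := by
        rw [smul_smul, mul_div_cancel₀ _ ht, neg_smul]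
        exact eq_neg_of_add_eq_zero_right h1
      exact smul_right_injective _ ht h3
    exact h2
  refine ⟨?_, ht⟩
  -- On an empty manifold any two metrics are proportional.
  have : Nonempty M := by
    by_contra hM
    rw [not_nonempty_iff] at hM
    exact h ⟨0, fun x => hM.elim x⟩
  rw [ht, zero_smul, add_zero] at hst
  exact (smul_eq_zero.mp hst).resolve_right g.sigma_ne_zero

theorem exists_combination {g g' : Metric 3 M} (hmob : g.degreeOfMobility = 2)
    (hequiv : ProjectivelyEquivalent g g') (h : ¬ Proportional g g') {τ : WeightedField 3 M}
    (hτ : τ ∈ g.solSpace) : ∃ s t : ℝ, τ = s • g.sigma + t • g'.sigma := by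
  have hg : g.sigma ∈ g.solSpace :=
    ProjectivelyEquivalent.sigma_mem_solSpace fun _ _ _ _ => Iff.rfl
  set b : Fin 2 → g.solSpace := ![⟨g.sigma, hg⟩, ⟨g'.sigma, hequiv.sigma_mem_solSpace⟩] with hb
  have hli : LinearIndependent ℝ b := by
    rw [hb, LinearIndependent.pair_iff]
    intro s t hst
    exact sigma_linearIndependent h (congrArg Subtype.val hst)
  have hrank : Module.finrank ℝ g.solSpace = 2 := by
    have : Module.rank ℝ g.solSpace = 2 := hmob
    rw [Module.finrank, this]
    simp
  have hspan := hli.span_eq_top_of_card_eq_finrank (by simp [hrank])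
  have hmem : (⟨τ, hτ⟩ : g.solSpace) ∈ Submodule.span ℝ (Set.range b) := by
    rw [hspan]; trivial
  rw [hb, Matrix.range_cons, Matrix.range_cons, Matrix.range_empty, Set.union_empty,
    Set.singleton_union, Submodule.mem_span_pair] at hmem
  obtain ⟨s, t, hst⟩ := hmem
  exact ⟨s, t, (congrArg Subtype.val hst).symm⟩

theorem existsUnique_isActionMatrix [IsManifold (𝓡 3) ∞ M] {g g' : Metric 3 M}
    (hmob : g.degreeOfMobility = 2) (hv : g.IsProjectiveVectorField v)
    (hequiv : ProjectivelyEquivalent g g') (h : ¬ Proportional g g') :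
    ∃! A : Matrix (Fin 2) (Fin 2) ℝ, IsActionMatrix v g.sigma g'.sigma A := by
  have hg : g.sigma ∈ g.solSpace :=
    ProjectivelyEquivalent.sigma_mem_solSpace fun _ _ _ _ => Iff.rfl
  have hg' := hequiv.sigma_mem_solSpace
  obtain ⟨a, b, hab⟩ := exists_combination hmob hequiv h (lieField_mem_solSpace hv hg)
  obtain ⟨c, d, hcd⟩ := exists_combination hmob hequiv h (lieField_mem_solSpace hv hg')
  have huniq : ∀ {s t s' t' : ℝ}, s • g.sigma + t • g'.sigma = s' • g.sigma + t' • g'.sigma →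
      s = s' ∧ t = t' := by
    intro s t s' t' hst
    have := sigma_linearIndependent h (s := s - s') (t := t - t') (by
      refine Eq.trans ?_ (sub_eq_zero.mpr hst)
      module)
    exact ⟨sub_eq_zero.mp this.1, sub_eq_zero.mp this.2⟩
  refine ⟨!![a, b; c, d], ?_, fun B hB => ?_⟩
  · exact (isActionMatrix_iff hv.1 hg hg' _).mpr ⟨hab, hcd⟩
  · obtain ⟨h1, h2⟩ := (isActionMatrix_iff hv.1 hg hg' _).mp hB
    rw [hab] at h1
    rw [hcd] at h2
    obtain ⟨e1, e2⟩ := huniq h1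
    obtain ⟨e3, e4⟩ := huniq h2
    ext i j
    fin_cases i <;> fin_cases j <;> simp [e1, e2, e3, e4]

end

/-! ### Evolution of the eigenvalues -/

section Evolution

variable {𝕜 : Type*} [RCLike 𝕜]

/-- Uniqueness against the zero solution; a bound on `k` already provides the Lipschitz constant.
The times `t` and `s` may come in either order. -/
theorem eq_zero_of_linear_ode {d k : ℝ → 𝕜} {a b : ℝ} {C : NNReal}
    (hk : ∀ s ∈ Ioo a b, ‖k s‖ ≤ C) (hd : ∀ s ∈ Ioo a b, HasDerivAt d (k s * d s) s)
    {t s : ℝ} (ht : t ∈ Ioo a b) (hs : s ∈ Ioo a b) (h : d t = 0) : d s = 0 := by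
  refine ODE_solution_unique_of_mem_Ioo (v := fun s x => k s * x) (s := fun _ => univ) (K := C)
    (g := fun _ => 0) (fun s hs => ?_) ht (fun s hs => ⟨hd s hs, mem_univ _⟩)
    (fun s _ => ⟨by simpa using hasDerivAt_const s (0 : 𝕜), mem_univ _⟩) h hs
  refine LipschitzOnWith.of_dist_le_mul fun x _ y _ => ?_
  rw [dist_eq_norm, dist_eq_norm, ← mul_sub, norm_mul]
  exact mul_le_mul_of_nonneg_right (hk s hs) (norm_nonneg _)

/-- The linear map `r ↦ r A` on row vectors. -/
def rowMul (𝕜 : Type*) [RCLike 𝕜] (A : Matrix (Fin 2) (Fin 2) ℝ) : 𝕜 × 𝕜 →L[ℝ] 𝕜 × 𝕜 :=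
  (A 0 0 • ContinuousLinearMap.fst ℝ 𝕜 𝕜 + A 1 0 • ContinuousLinearMap.snd ℝ 𝕜 𝕜).prod
    (A 0 1 • ContinuousLinearMap.fst ℝ 𝕜 𝕜 + A 1 1 • ContinuousLinearMap.snd ℝ 𝕜 𝕜)

theorem rowMul_apply (A : Matrix (Fin 2) (Fin 2) ℝ) (r : 𝕜 × 𝕜) :
    rowMul 𝕜 A r = (A 0 0 • r.1 + A 1 0 • r.2, A 0 1 • r.1 + A 1 1 • r.2) := rfl

theorem exists_linear_flow {F : Type*} [NormedAddCommGroup F] [NormedSpace ℝ F] [CompleteSpace F]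
    (B : F →L[ℝ] F) : ∃ R : ℝ → F →L[ℝ] F, R 0 = ContinuousLinearMap.id ℝ F ∧
      ∀ s, HasDerivAt R (B.comp (R s)) s :=
  ⟨fun s => NormedSpace.exp (s • B), by
    change NormedSpace.exp ((0 : ℝ) • B) = 1
    rw [zero_smul, NormedSpace.exp_zero],
    fun s => hasDerivAt_exp_smul_const' (𝕂 := ℝ) B s⟩

theorem hasDerivAt_linear_flow_sub {F : Type*} [NormedAddCommGroup F] [NormedSpace ℝ F]
    {B : F →L[ℝ] F} {R : ℝ → F →L[ℝ] F} (hR : ∀ s, HasDerivAt R (B.comp (R s)) s) (t s : ℝ) (x : F) :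
    HasDerivAt (fun s => R (t - s) x) (-(B (R (t - s) x))) s := by
  have h1 : HasDerivAt (fun u => R u x) (B (R (t - s) x)) (t - s) :=
    ((hR (t - s)).clm_apply (hasDerivAt_const (t - s) x)).congr_deriv (by simp)
  exact h1.comp_const_sub t s

theorem hasMatDeriv_map {F : Type*} [NormedAddCommGroup F] [NormedSpace ℝ F]
    {T : F → Matrix (Fin 3) (Fin 3) ℝ} {T' : Matrix (Fin 3) (Fin 3) ℝ} {w p : F}
    (hT : HasMatDeriv T w T' p) :
    HasMatDeriv (fun z => (T z).map (algebraMap ℝ 𝕜)) w (T'.map (algebraMap ℝ 𝕜)) p := by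
  intro i j
  obtain ⟨L, hL, h⟩ := hT i j
  exact ⟨_, (algebraMapCLM ℝ 𝕜).hasFDerivAt.comp p hL, by simp [h]⟩

/-- A matrix evolving by `K' = C K + K Cᵀ - ½ tr(C) K` has `(det K)' = ½ tr(C) det K`. -/
theorem hasDerivAt_det_of_evolution {K : ℝ → Matrix (Fin 3) (Fin 3) 𝕜}
    {C : Matrix (Fin 3) (Fin 3) 𝕜} {s : ℝ}
    (hK : HasMatDeriv K 1 (C * K s + K s * C.transpose - ((1 / 2) * C.trace) • K s) s) :
    HasDerivAt (fun s => (K s).det) ((1 / 2) * C.trace * (K s).det) s := by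
  refine (hasDirDeriv_one_iff.mp hK.det).congr_deriv ?_
  -- The three contributions to Jacobi's formula are `1`, `1` and `-3/2` times `tr(C) det K`.
  have h1 : ((K s).adjugate * (C * K s)).trace = (K s).det * C.trace := by
    rw [Matrix.trace_mul_comm, Matrix.mul_assoc, Matrix.mul_adjugate, Matrix.mul_smul,
      Matrix.mul_one, Matrix.trace_smul, smul_eq_mul]
  have h2 : ((K s).adjugate * (K s * C.transpose)).trace = (K s).det * C.trace := by
    rw [← Matrix.mul_assoc, Matrix.adjugate_mul, Matrix.smul_mul, Matrix.one_mul,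
      Matrix.trace_smul, smul_eq_mul, Matrix.trace_transpose]
  have h3 : ((K s).adjugate * K s).trace = 3 * (K s).det := by
    rw [Matrix.adjugate_mul, Matrix.trace_smul, Matrix.trace_one, smul_eq_mul]
    simp [mul_comm]
  rw [Matrix.mul_sub, Matrix.mul_add, Matrix.trace_sub, Matrix.trace_add, h1, h2, Matrix.mul_smul,
    Matrix.trace_smul, h3, smul_eq_mul]
  ring

/-- The roots are eigenvalues of `T S⁻¹`. Their finiteness isolates each one, whatever its
multiplicity. -/
theorem finite_pencil_roots {S T : Matrix (Fin 3) (Fin 3) 𝕜} (h : S.det ≠ 0) :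
    {μ : 𝕜 | (T - μ • S).det = 0}.Finite := by
  refine ((T * S⁻¹).charpoly.roots.toFinset.finite_toSet).subset fun μ hμ => ?_
  have hu : IsUnit S.det := isUnit_iff_ne_zero.mpr h
  rw [Finset.mem_coe, Multiset.mem_toFinset,
    Polynomial.mem_roots (Matrix.charpoly_monic _).ne_zero, Polynomial.IsRoot,
    Matrix.eval_charpoly]
  have h1 : Matrix.scalar (Fin 3) μ - T * S⁻¹ = -((T - μ • S) * S⁻¹) := by
    rw [Matrix.sub_mul, Matrix.smul_mul, Matrix.mul_nonsing_inv _ hu, neg_sub, Matrix.scalar_apply,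
      ← Matrix.smul_one_eq_diagonal]
  rw [h1, Matrix.det_neg, Matrix.det_mul, show (T - μ • S).det = 0 from hμ]
  simp

/-- The members of a pencil `r₁ S + r₂ T` that are singular at time `t` are carried by the linear
flow of `A` to members that are singular at time zero. -/
theorem det_pencil_transport {S T C : ℝ → Matrix (Fin 3) (Fin 3) ℝ}
    {A : Matrix (Fin 2) (Fin 2) ℝ} {η : ℝ}
    (hS : ∀ s ∈ Ioo (-η) η, HasMatDeriv S 1 (C s * S s + S s * (C s).transpose
      - ((1 / 2) * (C s).trace) • S s + (A 0 0 • S s + A 0 1 • T s)) s)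
    (hT : ∀ s ∈ Ioo (-η) η, HasMatDeriv T 1 (C s * T s + T s * (C s).transpose
      - ((1 / 2) * (C s).trace) • T s + (A 1 0 • S s + A 1 1 • T s)) s)
    {c : NNReal} (hbound : ∀ s ∈ Ioo (-η) η, ‖(C s).trace‖ ≤ c)
    {R : ℝ → 𝕜 × 𝕜 →L[ℝ] 𝕜 × 𝕜} (hR0 : R 0 = ContinuousLinearMap.id ℝ (𝕜 × 𝕜))
    (hR : ∀ s, HasDerivAt R ((rowMul 𝕜 A).comp (R s)) s) {t : ℝ} (ht : t ∈ Ioo (-η) η)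
    {r : 𝕜 × 𝕜}
    (h : (r.1 • (S t).map (algebraMap ℝ 𝕜) + r.2 • (T t).map (algebraMap ℝ 𝕜)).det = 0) :
    ((R t r).1 • (S 0).map (algebraMap ℝ 𝕜) + (R t r).2 • (T 0).map (algebraMap ℝ 𝕜)).det = 0 := by
  have h00 : (0 : ℝ) ∈ Ioo (-η) η := by
    constructor <;> linarith [ht.1, ht.2]
  have htr : ∀ s, ((C s).map (algebraMap ℝ 𝕜)).trace = algebraMap ℝ 𝕜 (C s).trace := fun s =>
    (AddMonoidHom.map_trace (algebraMap ℝ 𝕜).toAddMonoidHom _).symm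
  have hbound' : ∀ s ∈ Ioo (-η) η, ‖(1 / 2) * ((C s).map (algebraMap ℝ 𝕜)).trace‖ ≤ c := by
    intro s hs
    have h1 : ‖(1 / 2 : 𝕜)‖ = 1 / 2 := by simp
    rw [htr, norm_mul, norm_algebraMap', h1]
    linarith [hbound s hs, norm_nonneg (C s).trace]
  -- `ρ` solves `ρ' = -ρ A` and runs from `R t r` at `s = 0` to `r` at `s = t`. In the derivative of
  -- `ρ₁ S + ρ₂ T` the terms with `A` therefore cancel.
  set ρ : ℝ → 𝕜 × 𝕜 := fun s => R (t - s) r with hρ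
  have hρ' : ∀ s, HasDerivAt ρ (-(rowMul 𝕜 A (ρ s))) s := fun s =>
    hasDerivAt_linear_flow_sub hR t s r
  have hρ1 : ∀ s, HasDerivAt (fun s => (ρ s).1)
      (-(algebraMap ℝ 𝕜 (A 0 0) * (ρ s).1 + algebraMap ℝ 𝕜 (A 1 0) * (ρ s).2)) s := fun s =>
    HasDerivAt.congr_deriv (f' := (-(rowMul 𝕜 A (ρ s))).1) (hρ' s).fst
      (by simp only [rowMul_apply, Prod.fst_neg, Algebra.smul_def])
  have hρ2 : ∀ s, HasDerivAt (fun s => (ρ s).2)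
      (-(algebraMap ℝ 𝕜 (A 0 1) * (ρ s).1 + algebraMap ℝ 𝕜 (A 1 1) * (ρ s).2)) s := fun s =>
    HasDerivAt.congr_deriv (f' := (-(rowMul 𝕜 A (ρ s))).2) (hρ' s).snd
      (by simp only [rowMul_apply, Prod.snd_neg, Algebra.smul_def])
  have e1 : ∀ X Y : Matrix (Fin 3) (Fin 3) ℝ, (X + Y).map (algebraMap ℝ 𝕜)
      = X.map (algebraMap ℝ 𝕜) + Y.map (algebraMap ℝ 𝕜) := Matrix.map_add _ (map_add _)
  have e2 : ∀ X Y : Matrix (Fin 3) (Fin 3) ℝ, (X - Y).map (algebraMap ℝ 𝕜)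
      = X.map (algebraMap ℝ 𝕜) - Y.map (algebraMap ℝ 𝕜) := Matrix.map_sub _ (map_sub _)
  have e3 : ∀ (c : ℝ) (X : Matrix (Fin 3) (Fin 3) ℝ), (c • X).map (algebraMap ℝ 𝕜)
      = algebraMap ℝ 𝕜 c • X.map (algebraMap ℝ 𝕜) := by
    intro c X
    ext i j
    simp
  have hK : ∀ s ∈ Ioo (-η) η, HasDerivAt
      (fun s => ((ρ s).1 • (S s).map (algebraMap ℝ 𝕜) + (ρ s).2 • (T s).map (algebraMap ℝ 𝕜)).det)
      ((1 / 2) * ((C s).map (algebraMap ℝ 𝕜)).trace *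
        ((ρ s).1 • (S s).map (algebraMap ℝ 𝕜) + (ρ s).2 • (T s).map (algebraMap ℝ 𝕜)).det) s := by
    intro s hs
    refine hasDerivAt_det_of_evolution
      (K := fun s => (ρ s).1 • (S s).map (algebraMap ℝ 𝕜) + (ρ s).2 • (T s).map (algebraMap ℝ 𝕜)) ?_
    have h1 := (HasMatDeriv.smul (hasDirDeriv_one_iff.mpr (hρ1 s))
      (hasMatDeriv_map (𝕜 := 𝕜) (hS s hs))).add
      (HasMatDeriv.smul (hasDirDeriv_one_iff.mpr (hρ2 s)) (hasMatDeriv_map (𝕜 := 𝕜) (hT s hs)))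
    have e5 : algebraMap ℝ 𝕜 (1 / 2 * (C s).trace) = 1 / 2 * algebraMap ℝ 𝕜 (C s).trace := by
      rw [map_mul, map_div₀, map_one, map_ofNat]
    have e6 : ∀ {X Y : Matrix (Fin 3) (Fin 3) 𝕜} {F : ℝ → Matrix (Fin 3) (Fin 3) 𝕜},
        HasMatDeriv F 1 X s → X = Y → HasMatDeriv F 1 Y s := fun h e => e ▸ h
    refine e6 h1 ?_
    rw [htr]
    simp only [e1, e2, e3, Matrix.map_mul, Matrix.transpose_map, e5, Matrix.mul_add, Matrix.add_mul,
      Matrix.mul_smul, Matrix.smul_mul]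
    module
  have h0 := eq_zero_of_linear_ode hbound' hK ht h00 (by
    have : ρ t = r := by simp [hρ, hR0]
    rw [this, h])
  simpa only [hρ, sub_zero] using h0

/-- If `S`, `T` evolve by `S' = 𝓛 S + a S + b T`, `T' = 𝓛 T + c S + d T` with
`𝓛 S = C S + S Cᵀ - ½ tr(C) S`, then a differentiable root `μ` of `det (T - μ S) = 0` evolves by
Solodovnikov's polynomial. -/
theorem deriv_pencil_root {S T C : ℝ → Matrix (Fin 3) (Fin 3) ℝ} {A : Matrix (Fin 2) (Fin 2) ℝ}
    {η : ℝ} (hη : 0 < η)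
    (hS : ∀ s ∈ Ioo (-η) η, HasMatDeriv S 1 (C s * S s + S s * (C s).transpose
      - ((1 / 2) * (C s).trace) • S s + (A 0 0 • S s + A 0 1 • T s)) s)
    (hT : ∀ s ∈ Ioo (-η) η, HasMatDeriv T 1 (C s * T s + T s * (C s).transpose
      - ((1 / 2) * (C s).trace) • T s + (A 1 0 • S s + A 1 1 • T s)) s)
    {c : NNReal} (hbound : ∀ s ∈ Ioo (-η) η, ‖(C s).trace‖ ≤ c) (hdet : (S 0).det ≠ 0)
    {μ : ℝ → 𝕜} {μ' : 𝕜} (hμ : HasDerivAt μ μ' 0)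
    (hroot : ∀ s ∈ Ioo (-η) η,
      ((T s).map (algebraMap ℝ 𝕜) - μ s • (S s).map (algebraMap ℝ 𝕜)).det = 0) :
    Polynomial.aeval (μ 0) (solodovnikov A) = μ' := by
  obtain ⟨R, hR0, hR⟩ := exists_linear_flow (rowMul 𝕜 A)
  set S₀ := (S 0).map (algebraMap ℝ 𝕜) with hS₀
  set T₀ := (T 0).map (algebraMap ℝ 𝕜) with hT₀
  set r : ℝ → 𝕜 × 𝕜 := fun t => R t (-μ t, 1) with hr
  have htrans : ∀ t ∈ Ioo (-η) η, ((r t).1 • S₀ + (r t).2 • T₀).det = 0 := by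
    intro t ht
    refine det_pencil_transport hS hT hbound hR0 hR ht ?_
    rw [← hroot t ht]
    congr 1
    module
  have hr0 : r 0 = (-μ 0, 1) := by simp [hr, hR0]
  have hr' : HasDerivAt r (rowMul 𝕜 A (-μ 0, 1) + (-μ', 0)) 0 := by
    have h1 := (hR 0).clm_apply (hμ.neg.prodMk (hasDerivAt_const (0 : ℝ) (1 : 𝕜)))
    refine h1.congr_deriv ?_
    simp [hR0]
  have hrc := hr'.continuousAt
  have hne : ∀ᶠ t in nhds (0 : ℝ), (r t).2 ≠ 0 :=
    hrc.snd.eventually_ne (by rw [hr0]; exact one_ne_zero)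
  have hquot : ContinuousAt (fun t => -(r t).1 / (r t).2) 0 :=
    hrc.fst.neg.div hrc.snd (by rw [hr0]; exact one_ne_zero)
  have hdet' : S₀.det ≠ 0 := by
    have h1 : S₀.det = algebraMap ℝ 𝕜 (S 0).det := (RingHom.map_det (algebraMap ℝ 𝕜) (S 0)).symm
    rw [h1]
    simpa using hdet
  -- the roots at time zero are isolated
  have hfin := (finite_pencil_roots (T := T₀) hdet').subset (sdiff_subset (t := {μ 0}))
  have hopen : ∀ᶠ t in nhds (0 : ℝ), -(r t).1 / (r t).2 ∉
      {μ : 𝕜 | (T₀ - μ • S₀).det = 0} \ {μ 0} :=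
    hquot.eventually (hfin.isClosed.isOpen_compl.eventually_mem (by simp [hr0]))
  -- The ratio `-r₁/r₂` is a root of the pencil at time zero, starts at `μ 0`, and for small `t`
  -- avoids all other roots, so it equals `μ 0`.
  have hzero : ∀ᶠ t in nhds (0 : ℝ), (r t).1 + μ 0 * (r t).2 = 0 := by
    filter_upwards [hopen, hne, isOpen_Ioo.mem_nhds (by simp [hη] : (0 : ℝ) ∈ Ioo (-η) η)]
      with t h1 h2 h3
    have h4 : (T₀ - (-(r t).1 / (r t).2) • S₀).det = 0 := by
      have h5 : (r t).2 • (T₀ - (-(r t).1 / (r t).2) • S₀) = (r t).1 • S₀ + (r t).2 • T₀ := by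
        rw [smul_sub, smul_smul, mul_div_cancel₀ _ h2]
        module
      have h6 := htrans t h3
      rw [← h5, Matrix.det_smul] at h6
      exact (mul_eq_zero.mp h6).resolve_left (pow_ne_zero _ h2)
    have h7 : -(r t).1 / (r t).2 = μ 0 := by
      by_contra h8
      exact h1 ⟨h4, h8⟩
    rw [div_eq_iff h2] at h7
    linear_combination -h7
  have hr1 : HasDerivAt (fun t => (r t).1) (rowMul 𝕜 A (-μ 0, 1) + (-μ', 0)).1 0 := hr'.fst
  have hr2 : HasDerivAt (fun t => (r t).2) (rowMul 𝕜 A (-μ 0, 1) + (-μ', 0)).2 0 := hr'.snd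
  -- With `m = μ 0` this reads `(c - a m - μ') + m (d - b m) = 0`.
  have h2 := (hr1.add (hr2.const_mul (μ 0))).unique ((hasDerivAt_const (0 : ℝ) (0 : 𝕜)).congr_of_eventuallyEq hzero)
  simp only [rowMul_apply, Prod.fst_add, Prod.snd_add, Algebra.smul_def] at h2
  simp only [solodovnikov, map_add, map_neg, map_mul, map_pow, Polynomial.aeval_C,
    Polynomial.aeval_X, map_sub]
  linear_combination h2

end Evolution

/-! ### Eigenvalues of the Benenti tensor -/

section Benenti

variable {M : Type*} [TopologicalSpace M] [ChartedSpace (E 3) M] {e : OpenPartialHomeomorph M (E 3)}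
  {𝕜 : Type*} [RCLike 𝕜]

/-- This replaces the eigenvalue problem of `L` by the pencil `σ̄ - μ σ`, whose members obey the
same linear evolution along `v`. -/
theorem benenti_mul_sigma (g g' : Metric 3 M) (x : M) :
    benenti g g' x * g.sigma x = g'.sigma x := by
  have hg := g.det_gram_ne_zero x
  have hp : 0 < |(g.gram x).det| ^ (1 / (((3 : ℕ) : ℝ) + 1)) :=
    Real.rpow_pos_of_pos (abs_pos.mpr hg) _
  simp only [benenti, Metric.sigma]
  rw [Matrix.smul_mul, Matrix.mul_smul, Matrix.mul_assoc,
    Matrix.mul_nonsing_inv _ (isUnit_iff_ne_zero.mpr hg), Matrix.mul_one, smul_smul, abs_div,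
    Real.div_rpow (abs_nonneg _) (abs_nonneg _), div_mul_cancel₀ _ hp.ne']

theorem IsBenentiEigenvalue.det_eq_zero {g g' : Metric 3 M} {x : M} {μ : 𝕜}
    (h : IsBenentiEigenvalue g g' x μ) :
    ((g'.sigma x).map (algebraMap ℝ 𝕜) - μ • (g.sigma x).map (algebraMap ℝ 𝕜)).det = 0 := by
  obtain ⟨u, hu⟩ := h.exists_hasEigenvector
  have h1 := hu.apply_eq_smul
  rw [Matrix.toLin'_apply] at h1
  have h2 : ((benenti g g' x).map (algebraMap ℝ 𝕜) - μ • (1 : Matrix (Fin 3) (Fin 3) 𝕜)).det = 0 := by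
    refine Matrix.exists_mulVec_eq_zero_iff.mp ⟨u, hu.2, ?_⟩
    rw [Matrix.sub_mulVec, h1, Matrix.smul_mulVec, Matrix.one_mulVec, sub_self]
  have h3 : (g'.sigma x).map (algebraMap ℝ 𝕜) - μ • (g.sigma x).map (algebraMap ℝ 𝕜)
      = ((benenti g g' x).map (algebraMap ℝ 𝕜) - μ • (1 : Matrix (Fin 3) (Fin 3) 𝕜))
        * (g.sigma x).map (algebraMap ℝ 𝕜) := by
    rw [← benenti_mul_sigma g g', Matrix.map_mul, Matrix.sub_mul, Matrix.smul_mul, Matrix.one_mul]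
  rw [h3, Matrix.det_mul, h2, zero_mul]

/-- Both components arise by the same congruence and the same weight factor, so the determinant of
the pencil only acquires a factor. -/
theorem det_pencil_comp {σ σ' : WeightedField 3 M} (e : OpenPartialHomeomorph M (E 3)) (y : E 3)
    {μ : 𝕜} (h : ((σ' (e.symm y)).map (algebraMap ℝ 𝕜)
      - μ • (σ (e.symm y)).map (algebraMap ℝ 𝕜)).det = 0) :
    ((WeightedField.comp σ' e y).map (algebraMap ℝ 𝕜)
      - μ • (WeightedField.comp σ e y).map (algebraMap ℝ 𝕜)).det = 0 := by
  set J := (jac e (e.symm y)).map (algebraMap ℝ 𝕜)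
  set ρ := |(jac e (e.symm y)).det| ^ (-(2 / (((3 : ℕ) : ℝ) + 1)))
  have h1 : ∀ τ : WeightedField 3 M, (WeightedField.comp τ e y).map (algebraMap ℝ 𝕜)
      = algebraMap ℝ 𝕜 ρ • (J * (τ (e.symm y)).map (algebraMap ℝ 𝕜) * J.transpose) := by
    intro τ
    have h2 : ∀ X : Matrix (Fin 3) (Fin 3) ℝ, (ρ • X).map (algebraMap ℝ 𝕜)
        = algebraMap ℝ 𝕜 ρ • X.map (algebraMap ℝ 𝕜) := by
      intro X
      ext i j
      simp
    rw [WeightedField.comp, h2, Matrix.map_mul, Matrix.map_mul, Matrix.transpose_map]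
  have h3 : (WeightedField.comp σ' e y).map (algebraMap ℝ 𝕜)
      - μ • (WeightedField.comp σ e y).map (algebraMap ℝ 𝕜)
      = algebraMap ℝ 𝕜 ρ • (J * ((σ' (e.symm y)).map (algebraMap ℝ 𝕜)
        - μ • (σ (e.symm y)).map (algebraMap ℝ 𝕜)) * J.transpose) := by
    rw [h1, h1]
    simp only [Matrix.mul_sub, Matrix.sub_mul, Matrix.mul_smul, Matrix.smul_mul, smul_sub]
    rw [smul_comm]
  rw [h3, Matrix.det_smul, Matrix.det_mul, Matrix.det_mul, h]
  simp

theorem Metric.det_sigma_comp_ne_zero (g : Metric 3 M) (he : e ∈ charts 3 M) {y : E 3}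
    (hy : y ∈ e.target) : (WeightedField.comp g.sigma e y).det ≠ 0 := by
  have h0 := g.det_comp_ne_zero he hy
  have hp : 0 < |(g.comp e y).det| ^ (1 / (((3 : ℕ) : ℝ) + 1)) :=
    Real.rpow_pos_of_pos (abs_pos.mpr h0) _
  rw [g.sigma_comp he hy, Matrix.det_smul, Matrix.det_nonsing_inv, Ring.inverse_eq_inv']
  exact mul_ne_zero (pow_ne_zero _ hp.ne') (inv_ne_zero h0)

/-- The Lie derivative formula solved for its transport term, which along an integral curve is an
ordinary time derivative. -/
theorem hasMatDeriv_along_flow {V : E 3 → E 3} {S : E 3 → Matrix (Fin 3) (Fin 3) ℝ}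
    {Q : Matrix (Fin 3) (Fin 3) ℝ} {c : ℝ → E 3} {s : ℝ}
    (hS : ∀ i j, DifferentiableAt ℝ (fun z => S z i j) (c s)) (hc : HasDerivAt c (V (c s)) s)
    (hL : lieDeriv V S (c s) = Q) :
    HasMatDeriv (fun s => S (c s)) 1 (jacMat V (c s) * S (c s)
      + S (c s) * (jacMat V (c s)).transpose - ((1 / 2) * (jacMat V (c s)).trace) • S (c s) + Q)
      s := by
  have h1 : HasMatDeriv (fun s => S (c s)) 1
      (Matrix.of fun i j => fderiv ℝ (fun z => S z i j) (c s) (V (c s))) s := fun i j =>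
    hasDirDeriv_one_iff.mpr ((hS i j).hasFDerivAt.comp_hasDerivAt s hc)
  rw [lieDeriv_eq_matrix] at hL
  rw [← hL]
  convert! h1 using 1
  module

theorem hasDerivAt_of_comp_smulRight {V F : Type*} [NormedAddCommGroup V] [NormedSpace ℝ V]
    [NormedAddCommGroup F] [NormedSpace ℝ F] {f : ℝ → F} {D : V →L[ℝ] F} {w : V} {t : ℝ}
    (h : HasFDerivAt f (D.comp ((1 : ℝ →L[ℝ] ℝ).smulRight w)) t) : HasDerivAt f (D w) t := by
  simpa using h.hasDerivAt

theorem solodovnikov_eq_mfderiv {g g' : Metric 3 M} {v : ∀ x : M, TangentSpace (𝓡 3) x}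
    [IsManifold (𝓡 3) ∞ M] (hv : g.IsProjectiveVectorField v) {A : Matrix (Fin 2) (Fin 2) ℝ}
    (hA : IsActionMatrix v g.sigma g'.sigma A) {U : Set M} {ev : M → 𝕜} (hU : IsOpen U)
    (hev : MDifferentiableOn (𝓡 3) 𝓘(ℝ, 𝕜) ev U)
    (heig : ∀ x ∈ U, IsBenentiEigenvalue g g' x (ev x)) {x : M} (hx : x ∈ U) :
    Polynomial.aeval (ev x) (solodovnikov A) = (mfderiv (𝓡 3) 𝓘(ℝ, 𝕜) ev x (v x) : 𝕜) := by
  obtain ⟨hvs, hv⟩ := hv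
  obtain ⟨W, ε, φ, hW, hxW, hε, hφ, -⟩ := hv x
  set e := chartAt (E 3) x with hedef
  have he : e ∈ charts 3 M := IsManifold.chart_mem_maximalAtlas x
  have hxe : x ∈ e.source := mem_chart_source (E 3) x
  have h00 : (0 : ℝ) ∈ Ioo (-ε) ε := by simp [hε]
  have hφ0 : φ 0 x = x := hφ.initial x hxW
  have hcur := (hφ.integralCurve x hxW 0 h00).hasMFDerivAt (isOpen_Ioo.mem_nhds h00)
  have hcont : ContinuousAt (fun t => φ t x) 0 := hcur.continuousAt
  set c : ℝ → E 3 := fun t => e (φ t x) with hcdef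
  have hc0 : c 0 = e x := by simp only [hcdef, hφ0]
  have hctgt : e x ∈ e.target := e.map_source hxe
  have htr : ContinuousAt (fun s => (jacMat (vecComp v e) (c s)).trace) 0 := by
    have hcc : ContinuousAt c 0 :=
      (hφ.hasDerivAt he hxW h00 (by rw [hφ0]; exact hxe)).continuousAt
    have hvk : ∀ k, ContDiffOn ℝ ∞ (fun z => vecComp v e z k) e.target := fun k p hp =>
      ((EuclideanSpace.proj (𝕜 := ℝ) k).contDiff.contDiffAt).comp_contDiffWithinAt p (hvs e he p hp)
    have h1 : ContDiffOn ℝ ∞ (fun z => (jacMat (vecComp v e) z).trace) e.target :=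
      ContDiffOn.sum fun k _ => contDiffOn_pd e.open_target (hvk k) k
    have h2 : ContinuousAt (fun z => (jacMat (vecComp v e) z).trace) (c 0) := by
      rw [hc0]
      exact (h1.contDiffAt (e.open_target.mem_nhds hctgt)).continuousAt
    exact ContinuousAt.comp (g := fun z => (jacMat (vecComp v e) z).trace) h2 hcc
  -- For short times the integral curve stays in one chart and in `U`, and the divergence of `v`
  -- along it is bounded, as uniqueness for the determinant equation requires.
  obtain ⟨η, hη, hη'⟩ : ∃ η > 0, ∀ s ∈ Ioo (-η) η, s ∈ Ioo (-ε) ε ∧ φ s x ∈ e.source ∧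
      φ s x ∈ U ∧ ‖(jacMat (vecComp v e) (c s)).trace‖
        < ‖(jacMat (vecComp v e) (c 0)).trace‖ + 1 := by
    have h1 : ∀ᶠ s in nhds (0 : ℝ), s ∈ Ioo (-ε) ε ∧ φ s x ∈ e.source ∧ φ s x ∈ U ∧
        ‖(jacMat (vecComp v e) (c s)).trace‖ < ‖(jacMat (vecComp v e) (c 0)).trace‖ + 1 :=
      (isOpen_Ioo.eventually_mem h00).and
        ((hcont.eventually (e.open_source.eventually_mem (by simp only [hφ0]; exact hxe))).and
        ((hcont.eventually (hU.eventually_mem (by simp only [hφ0]; exact hx))).and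
        (htr.norm.eventually (gt_mem_nhds (lt_add_one _)))))
    obtain ⟨η, hη, h2⟩ := Metric.eventually_nhds_iff.mp h1
    refine ⟨η, hη, fun s hs => h2 ?_⟩
    rw [Real.dist_eq, sub_zero]
    exact abs_lt.mpr hs
  have hcs : ∀ s ∈ Ioo (-η) η, c s ∈ e.target := fun s hs => e.map_source (hη' s hs).2.1
  have hflow : ∀ s ∈ Ioo (-η) η, HasDerivAt c (vecComp v e (c s)) s := fun s hs =>
    hφ.hasDerivAt he hxW (hη' s hs).1 (hη' s hs).2.1
  have hdiff : ∀ (h : Metric 3 M), ∀ s ∈ Ioo (-η) η, ∀ i j,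
      DifferentiableAt ℝ (fun z => WeightedField.comp h.sigma e z i j) (c s) := fun h s hs i j =>
    ((h.contDiffOn_sigma_comp he i j).contDiffAt
      (e.open_target.mem_nhds (hcs s hs))).differentiableAt (by simp)
  have hmu : HasDerivAt (fun s => ev (φ s x)) (mfderiv (𝓡 3) 𝓘(ℝ, 𝕜) ev x (v x) : 𝕜) 0 := by
    -- `φ 0 x` equals `x` only propositionally, so the vectors at the two points are compared by
    -- heterogeneous equality.
    have key : ∀ z (p : E 3), z = x → HEq p (v x : E 3) →
        (mfderiv (𝓡 3) 𝓘(ℝ, 𝕜) ev z p : 𝕜) = (mfderiv (𝓡 3) 𝓘(ℝ, 𝕜) ev x (v x) : 𝕜) := by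
      rintro z p rfl h
      rw [eq_of_heq h]
    have hmd : MDifferentiableAt (𝓡 3) 𝓘(ℝ, 𝕜) ev (φ 0 x) := by
      rw [hφ0]
      exact (hev x hx).mdifferentiableAt (hU.mem_nhds hx)
    have h1 := (hmd.hasMFDerivAt.comp 0 hcur).hasFDerivAt
    have h2 := hasDerivAt_of_comp_smulRight (V := E 3) (F := 𝕜) (f := fun s => ev (φ s x))
      (D := mfderiv (𝓡 3) 𝓘(ℝ, 𝕜) ev (φ 0 x)) (w := v (φ 0 x)) h1
    refine h2.congr_deriv ?_
    exact key (φ 0 x) (v (φ 0 x)) hφ0 (congr_arg_heq v hφ0)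
  have hmain := deriv_pencil_root (𝕜 := 𝕜) (A := A) hη
    (S := fun s => WeightedField.comp g.sigma e (c s))
    (T := fun s => WeightedField.comp g'.sigma e (c s))
    (C := fun s => jacMat (vecComp v e) (c s))
    (c := ⟨‖(jacMat (vecComp v e) (c 0)).trace‖ + 1, by positivity⟩)
    (fun s hs => hasMatDeriv_along_flow (hdiff g s hs) (hflow s hs) (hA e he _ (hcs s hs)).1)
    (fun s hs => hasMatDeriv_along_flow (hdiff g' s hs) (hflow s hs) (hA e he _ (hcs s hs)).2)
    (fun s hs => (hη' s hs).2.2.2.le)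
    (g.det_sigma_comp_ne_zero he (hcs 0 (by simp [hη]))) hmu
    (fun s hs => by
      refine det_pencil_comp e (c s) ?_
      have h1 : e.symm (c s) = φ s x := e.left_inv (hη' s hs).2.1
      rw [h1]
      exact (heig _ (hη' s hs).2.2.1).det_eq_zero)
  simpa only [hφ0] using hmain

end Benenti

end ProjGeom

end

/-! ### The main theorem -/

open ProjGeom in
theorem lemma3p6 {M : Type*} [TopologicalSpace M] [ChartedSpace (E 3) M]
    [IsManifold (𝓡 3) ∞ M] {𝕜 : Type*} [RCLike 𝕜]
    (g gbar : Metric 3 M) (v : ∀ x : M, TangentSpace (𝓡 3) x)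
    (hmob : g.degreeOfMobility = 2)
    (hv : g.IsProjectiveVectorField v)
    (hequiv : ProjectivelyEquivalent g gbar)
    (hnonprop : ¬ Proportional g gbar) :
    (∃! A : Matrix (Fin 2) (Fin 2) ℝ, IsActionMatrix v g.sigma gbar.sigma A) ∧
    ∀ A : Matrix (Fin 2) (Fin 2) ℝ, IsActionMatrix v g.sigma gbar.sigma A →
      ∀ (U : Set M) (ev : M → 𝕜), IsOpen U → MDifferentiableOn (𝓡 3) 𝓘(ℝ, 𝕜) ev U →
        (∀ x ∈ U, IsBenentiEigenvalue g gbar x (ev x)) →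
        (∀ x ∈ U, Polynomial.aeval (ev x) (solodovnikov A)
          = (mfderiv (𝓡 3) 𝓘(ℝ, 𝕜) ev x (v x) : 𝕜)) ∧
        (∀ μ : 𝕜, U.Nonempty → (∀ x ∈ U, ev x = μ) →
          Polynomial.aeval μ (solodovnikov A) = 0) := by
  refine ⟨existsUnique_isActionMatrix hmob hv hequiv hnonprop, fun A hA U ev hU hev heig => ?_⟩
  have hmain := fun x (hx : x ∈ U) => solodovnikov_eq_mfderiv hv hA hU hev heig hx
  refine ⟨hmain, fun μ hne hconst => ?_⟩
  obtain ⟨x, hx⟩ := hne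
  have h1 : ev =ᶠ[nhds x] fun _ => μ := Filter.mem_of_superset (hU.mem_nhds hx) hconst
  have h2 : mfderiv (𝓡 3) 𝓘(ℝ, 𝕜) ev x = 0 :=
    ((hasMFDerivAt_const μ x).congr_of_eventuallyEq h1).mfderiv
  have h3 := hmain x hx
  rw [h2, hconst x hx] at h3
  exact h3
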